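/- Let $S^3\subset\mathbb H$ be the group of unit quaternions. For $\eta>0$ let $g_\eta$ be the Berger metric, i.e. the left-invariant Riemannian metric on $S^3$ for which the left-invariant vector fields $X_1,X_2,X_3$ with $X_1(p)=pi$, $X_2(p)=pj$, $X_3(p)=pk$ are pairwise orthogonal with $\|X_1\|=\eta$ and $\|X_2\|=\|X_3\|=1$ (so $g_\eta$ is the round metric with the fibres $t\mapsto p\exp(ti)$ of the Hopf fibration scaled by $\eta$). Then: 1. $S^3$ is a compact simply connected manifold. 2. For every $\eta>0$, every plane containing $X_1$ has $g_\eta$-sectional curvature $\eta^2$, and $\sec_{g_\eta}(X_2,X_3)=4-3\eta^2$. The set of all sectional curvatures of $g_\eta$ is exactly the closed interval with end points $\eta^2$ and $4-3\eta^2$. Every Hopf fibre has $g_\eta$-length $2\pi\eta$. 3. Let $\bar g_\eta=\eta^2 g_\eta$ be the normalized Berger metric. - If $0<\eta<1$, then $\sec_{\bar g_\eta}\ge 1$. - If $\eta>1$, then $\sec_{\bar g_\eta}\le 1$. If moreover $\eta<2/\sqrt3$, then $\sec_{\bar g_\eta}>0$. In both cases $(S^3,\bar g_\eta)$ is not a symmetric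 space, and not even locally symmetric. In both cases, for every unit speed geodesic $\gamma$ of $\bar g_\eta$ (defined on any open interval) there is a nowhere vanishing Jacobi field $J$ along $\gamma$ with $J\perp\gamma'$ and $\sec_{\bar g_\eta}(\gamma'(t),J(t))=1$ for all $t$. Hence $(S^3,\bar g_\eta)$ has weak lower spherical rank at least $1$ for $\eta<1$ and weak upper spherical rank at least $1$ for $\eta>1$, where these terms mean: compact, $\sec\ge1$ (respectively $\sec\le1$), and along every geodesic there is a normal Jacobi field $J$ with $\sec(\gamma',J)=1$. So rank rigidity fails for weak spherical rank. -/

import Mathlib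

open scoped Manifold ContDiff Bundle Quaternion
open Bundle

noncomputable section

/-! A positive definite form on a finite-dimensional tangent space has a bounded unit ball. -/

theorem isVonNBounded_of_pos {E : Type*} [NormedAddCommGroup E] [NormedSpace ℝ E]
    [FiniteDimensional ℝ E] {H : Type*} [TopologicalSpace H] {I : ModelWithCorners ℝ E H}
    {M : Type*} [TopologicalSpace M] [ChartedSpace H M] (x : M)
    (b : TangentSpace I x →L[ℝ] TangentSpace I x →L[ℝ] ℝ) (hb : ∀ v, v ≠ 0 → 0 < b v v) :
    Bornology.IsVonNBounded ℝ {v : TangentSpace I x | b v v < 1} := by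
  have key : ∀ b : E →L[ℝ] E →L[ℝ] ℝ, (∀ v, v ≠ 0 → 0 < b v v) →
      Bornology.IsVonNBounded ℝ {v : E | b v v < 1} := by
    intro b hb
    rw [NormedSpace.isVonNBounded_iff]
    have hc : Continuous fun v : E ↦ b v v := by fun_prop
    rcases (Metric.sphere (0 : E) 1).eq_empty_or_nonempty with h0 | hne
    · refine (Bornology.isBounded_singleton (x := (0 : E))).subset fun v _ ↦ ?_
      by_contra hv
      have hv : v ≠ 0 := hv
      have : ‖v‖⁻¹ • v ∈ Metric.sphere (0 : E) 1 := by simp [norm_smul, hv]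
      simp [h0] at this
    · obtain ⟨u, hu, hmin⟩ := (isCompact_sphere (0 : E) 1).exists_isMinOn hne hc.continuousOn
      have hu0 : u ≠ 0 := by rintro rfl; simp at hu
      have hm := hb u hu0
      refine (Metric.isBounded_closedBall (x := (0 : E)) (r := 1 + (b u u)⁻¹)).subset fun v hv ↦ ?_
      have hv : b v v < 1 := hv
      rw [mem_closedBall_zero_iff]
      by_cases hv0 : v = 0
      · subst hv0; simp; positivity
      have hn : 0 < ‖v‖ := norm_pos_iff.2 hv0
      have h1 : b u u ≤ b (‖v‖⁻¹ • v) (‖v‖⁻¹ • v) :=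
        hmin (show ‖v‖⁻¹ • v ∈ Metric.sphere (0 : E) 1 by simp [norm_smul, hv0])
      have h2 : b u u * ‖v‖ ^ 2 ≤ b v v := by
        have h3 : b (‖v‖⁻¹ • v) (‖v‖⁻¹ • v) = b v v / ‖v‖ ^ 2 := by
          simp; field_simp
        rw [h3, le_div_iff₀ (by positivity)] at h1
        exact h1
      have h4 : ‖v‖ ^ 2 ≤ (b u u)⁻¹ := by
        rw [← one_div, le_div_iff₀ hm]; linarith
      nlinarith [sq_nonneg (‖v‖ - 1)]
  exact key b hb

/-! ## Riemannian geometry of a smooth manifold -/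

section Riemannian

variable {E : Type*} [NormedAddCommGroup E] [NormedSpace ℝ E]
  {H : Type*} [TopologicalSpace H] {I : ModelWithCorners ℝ E H}
  {M : Type*} [TopologicalSpace M] [ChartedSpace H M] [IsManifold I ∞ M]

variable (I M) in
/-- A smooth Riemannian metric on the manifold `M`. -/
abbrev SmoothMetric : Type _ :=
  ContMDiffRiemannianMetric I ∞ E (fun x : M ↦ TangentSpace I x)

/-- `cov` is the Levi-Civita connection of `g`: a covariant derivative on the tangent bundle which
is torsion free and compatible with `g`. Here `cov Y x v` is `∇_v Y` at the point `x`. -/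
structure IsLeviCivita (g : SmoothMetric I M)
    (cov : (Π x : M, TangentSpace I x) → Π x : M, TangentSpace I x →L[ℝ] TangentSpace I x) :
    Prop where
  isCovariantDerivative : IsCovariantDerivativeOn E cov Set.univ
  torsion_free : ∀ (X Y : Π x : M, TangentSpace I x) (x : M),
    MDifferentiableAt I I.tangent (fun y ↦ (⟨y, X y⟩ : TangentBundle I M)) x →
    MDifferentiableAt I I.tangent (fun y ↦ (⟨y, Y y⟩ : TangentBundle I M)) x →
    cov Y x (X x) - cov X x (Y x) = VectorField.mlieBracket I X Y x
  metric_compatible : ∀ (Y Z : Π x : M, TangentSpace I x) (x : M),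
    MDifferentiableAt I I.tangent (fun y ↦ (⟨y, Y y⟩ : TangentBundle I M)) x →
    MDifferentiableAt I I.tangent (fun y ↦ (⟨y, Z y⟩ : TangentBundle I M)) x →
    ∀ v : TangentSpace I x,
      mvfderiv I (fun y ↦ g.inner y (Y y) (Z y)) x v
        = g.inner x (cov Y x v) (Z x) + g.inner x (Y x) (cov Z x v)

/-- The Levi-Civita connection of `g` (unique on differentiable vector fields). -/
def leviCivita (g : SmoothMetric I M) :
    (Π x : M, TangentSpace I x) → Π x : M, TangentSpace I x →L[ℝ] TangentSpace I x :=
  Classical.epsilon (IsLeviCivita g)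

/-- The curvature tensor `R(u, v) w = ∇_U ∇_V W - ∇_V ∇_U W - ∇_[U,V] W` at the point `x`, where
`U`, `V`, `W` are vector fields, smooth near `x`, that extend the tangent vectors `u`, `v`, `w`. -/
def curvatureTensor (g : SmoothMetric I M) (x : M) (u v w : TangentSpace I x) :
    TangentSpace I x :=
  let U : Π y : M, TangentSpace I y := FiberBundle.extend E u
  let V : Π y : M, TangentSpace I y := FiberBundle.extend E v
  let W : Π y : M, TangentSpace I y := FiberBundle.extend E w
  leviCivita g (fun y ↦ leviCivita g W y (V y)) x u
    - leviCivita g (fun y ↦ leviCivita g W y (U y)) x v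
    - leviCivita g W x (VectorField.mlieBracket I U V x)

/-- The sectional curvature of the plane spanned by the linearly independent vectors `v`, `w`. -/
def sectionalCurvature (g : SmoothMetric I M) (x : M) (v w : TangentSpace I x) : ℝ :=
  g.inner x (curvatureTensor g x v w w) v
    / (g.inner x v v * g.inner x w w - g.inner x v w ^ 2)

variable (I) in
/-- The velocity vector `γ'(t)` of a curve. -/
def velocity (γ : ℝ → M) (t : ℝ) : TangentSpace I (γ t) :=
  mfderiv 𝓘(ℝ, ℝ) I γ t (1 : ℝ)

/-- The covariant derivative `D V / dt` of a vector field `V` along the curve `γ`. In the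
trivialization of the tangent bundle given by the chart at `γ t`, it is the derivative of the
coordinates of `V` plus the Christoffel term, that is, the derivative in the direction `γ'(t)` of
the local vector field with constant coordinates that extends `V t`. -/
def covDerivAlong (g : SmoothMetric I M) (γ : ℝ → M) (V : Π t : ℝ, TangentSpace I (γ t)) (t : ℝ) :
    TangentSpace I (γ t) :=
  (trivializationAt E (TangentSpace I (M := M)) (γ t)).symm (γ t)
      (deriv (fun τ ↦ (trivializationAt E (TangentSpace I (M := M)) (γ t) ⟨γ τ, V τ⟩).2) t)
    + leviCivita g (FiberBundle.extend E (V t)) (γ t) (velocity I γ t)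

/-- `γ` restricted to the open set `s ⊆ ℝ` is a geodesic parameterized by arc length. -/
structure IsUnitSpeedGeodesicOn (g : SmoothMetric I M) (γ : ℝ → M) (s : Set ℝ) : Prop where
  smooth : ContMDiffOn 𝓘(ℝ, ℝ) I ∞ γ s
  unit_speed : ∀ t ∈ s, g.inner (γ t) (velocity I γ t) (velocity I γ t) = 1
  geodesic : ∀ t ∈ s, covDerivAlong g γ (velocity I γ) t = 0

/-- `J` is a Jacobi field along `γ` on the open set `s ⊆ ℝ`, namely `J'' + R(J, γ') γ' = 0`. -/
structure IsJacobiFieldOn (g : SmoothMetric I M) (γ : ℝ → M) (J : Π t : ℝ, TangentSpace I (γ t))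
    (s : Set ℝ) : Prop where
  smooth : ContMDiffOn 𝓘(ℝ, ℝ) I.tangent ∞ (fun t ↦ (⟨γ t, J t⟩ : TangentBundle I M)) s
  jacobi : ∀ t ∈ s, covDerivAlong g γ (covDerivAlong g γ J) t
    + curvatureTensor g (γ t) (J t) (velocity I γ t) (velocity I γ t) = 0

/-- Along every geodesic (defined on an arbitrary open interval `s`) there is a normal, nowhere
vanishing Jacobi field `J` such that `sec (γ', J) = 1` at all times. -/
def HasNormalJacobiFieldsOfCurvatureOne (g : SmoothMetric I M) : Prop :=
  ∀ (γ : ℝ → M) (s : Set ℝ), IsOpen s → s.OrdConnected → IsUnitSpeedGeodesicOn g γ s →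
    ∃ J : Π t : ℝ, TangentSpace I (γ t), IsJacobiFieldOn g γ J s ∧
      ∀ t ∈ s, J t ≠ 0 ∧ g.inner (γ t) (J t) (velocity I γ t) = 0 ∧
        sectionalCurvature g (γ t) (velocity I γ t) (J t) = 1

/-- All sectional curvatures are at most `c`. -/
def SecLE (g : SmoothMetric I M) (c : ℝ) : Prop :=
  ∀ (x : M) (v w : TangentSpace I x), LinearIndependent ℝ ![v, w] → sectionalCurvature g x v w ≤ c

/-- All sectional curvatures are at least `c`. -/
def SecGE (g : SmoothMetric I M) (c : ℝ) : Prop :=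
  ∀ (x : M) (v w : TangentSpace I x), LinearIndependent ℝ ![v, w] → c ≤ sectionalCurvature g x v w

/-- Weak upper spherical rank at least one. -/
def HasWeakUpperSphericalRank (g : SmoothMetric I M) : Prop :=
  CompactSpace M ∧ SecLE g 1 ∧ HasNormalJacobiFieldsOfCurvatureOne g

/-- Weak lower spherical rank at least one. -/
def HasWeakLowerSphericalRank (g : SmoothMetric I M) : Prop :=
  CompactSpace M ∧ SecGE g 1 ∧ HasNormalJacobiFieldsOfCurvatureOne g

/-- `(M, g)` is a symmetric space: at every point `p` there is an isometry of `M` that fixes `p`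
and has differential `-id` at `p`. -/
def IsSymmetricMetric (g : SmoothMetric I M) : Prop :=
  ∀ p : M, ∃ φ : M ≃ₘ⟮I, I⟯ M,
    (∀ (x : M) (v w : TangentSpace I x),
      g.inner (φ x) (mfderiv I I φ x v) (mfderiv I I φ x w) = g.inner x v w) ∧
    ∀ v : TangentSpace I p, tangentMap I I φ ⟨p, v⟩ = ⟨p, -v⟩

/-- `(M, g)` is locally symmetric: at every point `p` there is an isometric map, defined on a
neighbourhood of `p`, that fixes `p` and has differential `-id` at `p`. -/
def IsLocallySymmetricMetric (g : SmoothMetric I M) : Prop :=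
  ∀ p : M, ∃ (U : Set M) (φ : M → M), IsOpen U ∧ p ∈ U ∧ ContMDiffOn I I ∞ φ U ∧
    (∀ x ∈ U, ∀ v w : TangentSpace I x,
      g.inner (φ x) (mfderiv I I φ x v) (mfderiv I I φ x w) = g.inner x v w) ∧
    ∀ v : TangentSpace I p, tangentMap I I φ ⟨p, v⟩ = ⟨p, -v⟩

/-! The square of a smooth 1-form is smooth. -/

theorem contMDiff_smulRight_self {α : Π p : M, TangentSpace I p →L[ℝ] ℝ}
    (h : ContMDiff I (I.prod 𝓘(ℝ, E →L[ℝ] ℝ)) ∞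
      (fun p : M ↦ TotalSpace.mk' (E →L[ℝ] ℝ)
        (E := fun p : M ↦ (TangentSpace I p →L[ℝ] Trivial M ℝ p)) p (α p))) :
    ContMDiff I (I.prod 𝓘(ℝ, E →L[ℝ] E →L[ℝ] ℝ)) ∞
      (fun p : M ↦ TotalSpace.mk' (E →L[ℝ] E →L[ℝ] ℝ)
        (E := fun p : M ↦ (TangentSpace I p →L[ℝ] TangentSpace I p →L[ℝ] ℝ)) p
          ((α p).smulRight (α p))) := by
  intro p
  have h' := h p
  rw [contMDiffAt_hom_bundle] at h' ⊢
  refine ⟨contMDiffAt_id, ?_⟩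
  have h2 := h'.2
  have h3 : ContDiff ℝ ∞ (fun q : (E →L[ℝ] ℝ) × (E →L[ℝ] ℝ) ↦ q.1.smulRight q.2) :=
    isBoundedBilinearMap_smulRight.contDiff
  refine (h3.contMDiff.contMDiffAt.comp p (h2.prodMk_space h2)).congr_of_eventuallyEq ?_
  filter_upwards [(trivializationAt E (TangentSpace I (M := M)) p).open_baseSet.mem_nhds
    (mem_baseSet_trivializationAt _ _ p)] with q hq
  ext v w
  refine (inCoordinates_apply_eq₂ (E₃ := Trivial M ℝ) (F₃ := ℝ) hq hq
    (by simp)).trans ?_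
  have hs : ∀ u : E, (trivializationAt E (TangentSpace I (M := M)) p).symm q u
      = (trivializationAt E (TangentSpace I (M := M)) p).symmL ℝ q u :=
    fun u ↦ (Trivialization.symmL_apply _ hq u).symm
  simp only [ContinuousLinearMap.inCoordinates, hs]
  simp

set_option synthInstance.maxHeartbeats 200000 in
/-- The rescaled metric `c • g`. -/
def SmoothMetric.scale [FiniteDimensional ℝ E] (g : SmoothMetric I M) (c : ℝ) (hc : 0 < c) :
    SmoothMetric I M where
  inner x := c • g.inner x
  symm x v w := by simp [g.symm x v w]
  pos x v hv := by
    have := g.pos x v hv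
    simpa using mul_pos hc this
  isVonNBounded x := isVonNBounded_of_pos x _ fun v hv ↦ by
    have := g.pos x v hv
    simpa using mul_pos hc this
  contMDiff := g.contMDiff.const_smul_section (a := c)

end Riemannian

/-! ## The Berger metrics on the three-sphere -/

instance finrank_quaternion_fact : Fact (Module.finrank ℝ ℍ[ℝ] = 3 + 1) :=
  ⟨Quaternion.finrank_eq_four⟩

/-- The three-sphere, as the group of unit quaternions. -/
abbrev S3 : Type := Metric.sphere (0 : ℍ[ℝ]) 1

namespace S3

/-- The quaternion `i`. -/
def qi : ℍ[ℝ] := ⟨0, 1, 0, 0⟩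

/-- The quaternion `j`. -/
def qj : ℍ[ℝ] := ⟨0, 0, 1, 0⟩

/-- The quaternion `k`. -/
def qk : ℍ[ℝ] := ⟨0, 0, 0, 1⟩

/-- The inclusion of the tangent space of the sphere at `p` into the quaternions, that is, the
differential of the embedding. -/
def incl (p : S3) : TangentSpace (𝓡 3) p →L[ℝ] ℍ[ℝ] :=
  mvfderiv (𝓡 3) ((↑) : S3 → ℍ[ℝ]) p

/-- The left invariant 1-form `v ↦ ⟨v, p u⟩` on the sphere. For `u = i, j, k` these three forms are
dual to the left invariant fields `p i`, `p j`, `p k`, which are orthonormal in the round metric. -/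
def coframe (u : ℍ[ℝ]) (p : S3) : TangentSpace (𝓡 3) p →L[ℝ] ℝ :=
  (innerSL ℝ ((p : ℍ[ℝ]) * u)) ∘L incl p

theorem coframe_smooth (u : ℍ[ℝ]) :
    ContMDiff (𝓡 3) ((𝓡 3).prod 𝓘(ℝ, EuclideanSpace ℝ (Fin 3) →L[ℝ] ℝ)) ∞
    (fun p : S3 ↦ TotalSpace.mk' (EuclideanSpace ℝ (Fin 3) →L[ℝ] ℝ)
      (E := fun p : S3 ↦ (TangentSpace (𝓡 3) p →L[ℝ] Trivial S3 ℝ p)) p (coframe u p)) := by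
  intro p
  rw [contMDiffAt_hom_bundle]
  refine ⟨contMDiffAt_id, ?_⟩
  have h := (contMDiff_coe_sphere (m := ∞) (n := 3) (E := ℍ[ℝ]) p).mfderiv_const (m := ∞) le_rfl
  have h1 : ContMDiffAt (𝓡 3) 𝓘(ℝ, ℍ[ℝ] →L[ℝ] ℝ) ∞
      (fun q : S3 ↦ innerSL ℝ ((q : ℍ[ℝ]) * u)) p := by
    have h2 : ContDiff ℝ ∞ (fun q : ℍ[ℝ] ↦ innerSL ℝ (q * u)) :=
      (innerSL ℝ (E := ℍ[ℝ])).contDiff.comp (contDiff_id.mul contDiff_const)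
    exact h2.contMDiff.contMDiffAt.comp p (contMDiff_coe_sphere (m := ∞) (n := 3) (E := ℍ[ℝ]) p)
  refine (h1.clm_comp h).congr_of_eventuallyEq (Filter.Eventually.of_forall fun q ↦ ?_)
  ext v
  simp [ContinuousLinearMap.inCoordinates, inTangentCoordinates, coframe, incl, mvfderiv]
  rfl

/-- The bilinear form of the Berger metric at `p`: the fields `p i`, `p j`, `p k` are orthogonal,
of norm `η`, `1` and `1`. -/
def bergerForm (η : ℝ) (p : S3) :
    TangentSpace (𝓡 3) p →L[ℝ] TangentSpace (𝓡 3) p →L[ℝ] ℝ :=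
  η ^ 2 • (coframe qi p).smulRight (coframe qi p)
    + (coframe qj p).smulRight (coframe qj p)
    + (coframe qk p).smulRight (coframe qk p)

theorem bergerForm_pos {η : ℝ} (hη : 0 < η) (p : S3) (v : TangentSpace (𝓡 3) p) (hv : v ≠ 0) :
    0 < bergerForm η p v v := by
  have hinj : incl p v ≠ 0 := fun h ↦
    hv (injective_mvfderiv_subtypeVal_sphere (E := ℍ[ℝ]) (n := 3) p (h.trans (map_zero _).symm))
  have hperp : inner ℝ (p : ℍ[ℝ]) (incl p v) = 0 := by
    have h : incl p v ∈ (mvfderiv (𝓡 3) (Subtype.val : S3 → ℍ[ℝ]) p).range := ⟨v, rfl⟩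
    rw [range_mvfderiv_subtypeVal] at h
    exact Submodule.mem_orthogonal_singleton_iff_inner_right.1 h
  have hp : ‖(p : ℍ[ℝ])‖ = 1 := by simp
  have e : bergerForm η p v v = η ^ 2 * (coframe qi p v) ^ 2 + (coframe qj p v) ^ 2
      + (coframe qk p v) ^ 2 := by simp [bergerForm]; ring
  rw [e]
  by_contra hcon
  have hη2 : 0 < η ^ 2 := by positivity
  have hi : coframe qi p v = 0 := by
    by_contra h
    have : 0 < (coframe qi p v) ^ 2 := by positivity
    nlinarith [sq_nonneg (coframe qj p v), sq_nonneg (coframe qk p v), mul_pos hη2 this]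
  have hj : coframe qj p v = 0 := by
    by_contra h
    have : 0 < (coframe qj p v) ^ 2 := by positivity
    nlinarith [sq_nonneg (coframe qk p v), mul_nonneg hη2.le (sq_nonneg (coframe qi p v))]
  have hk : coframe qk p v = 0 := by
    by_contra h
    have : 0 < (coframe qk p v) ^ 2 := by positivity
    nlinarith [sq_nonneg (coframe qj p v), mul_nonneg hη2.le (sq_nonneg (coframe qi p v))]
  have hz : star (p : ℍ[ℝ]) * incl p v = 0 := by
    simp only [coframe, ContinuousLinearMap.comp_apply, innerSL_apply_apply,
      Quaternion.inner_def] at hi hj hk hperp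
    have c : (qi.re = 0 ∧ qi.imI = 1 ∧ qi.imJ = 0 ∧ qi.imK = 0) ∧
        (qj.re = 0 ∧ qj.imI = 0 ∧ qj.imJ = 1 ∧ qj.imK = 0) ∧
        (qk.re = 0 ∧ qk.imI = 0 ∧ qk.imJ = 0 ∧ qk.imK = 1) :=
      ⟨⟨rfl, rfl, rfl, rfl⟩, ⟨rfl, rfl, rfl, rfl⟩, ⟨rfl, rfl, rfl, rfl⟩⟩
    simp [c] at hi hj hk hperp
    ext <;> simp <;> linarith
  have hp0 : star (p : ℍ[ℝ]) ≠ 0 := by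
    rw [ne_eq, star_eq_zero]; intro h; simp [h] at hp
  exact hinj ((mul_eq_zero.1 hz).resolve_left hp0)

/-- The Berger metric `g_η`. -/
def bergerMetric (η : ℝ) (hη : 0 < η) : SmoothMetric (𝓡 3) S3 where
  inner p := bergerForm η p
  symm p v w := by simp [bergerForm]; ring
  pos p v hv := bergerForm_pos hη p v hv
  isVonNBounded p := isVonNBounded_of_pos p _ fun v hv ↦ bergerForm_pos hη p v hv
  contMDiff := (((contMDiff_smulRight_self (coframe_smooth qi)).const_smul_section
    (a := η ^ 2)).add_section (contMDiff_smulRight_self (coframe_smooth qj))).add_section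
    (contMDiff_smulRight_self (coframe_smooth qk))

/-- The normalized Berger metric `η² g_η`. -/
def normalizedBergerMetric (η : ℝ) (hη : 0 < η) : SmoothMetric (𝓡 3) S3 :=
  (bergerMetric η hη).scale (η ^ 2) (pow_pos hη 2)

/-- The quaternion `exp (t i) = cos t + sin t i`. -/
def expIQuaternion (t : ℝ) : ℍ[ℝ] := ⟨Real.cos t, Real.sin t, 0, 0⟩

theorem norm_expIQuaternion (t : ℝ) : ‖expIQuaternion t‖ = 1 := by
  rw [← pow_left_inj₀ (norm_nonneg _) zero_le_one two_ne_zero, sq,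
    ← Quaternion.normSq_eq_norm_mul_self, Quaternion.normSq_def']
  simp [expIQuaternion]

/-- The one-parameter group `exp (t i)` of unit quaternions. -/
def expI (t : ℝ) : S3 :=
  ⟨expIQuaternion t, mem_sphere_zero_iff_norm.2 (norm_expIQuaternion t)⟩

/-- The Hopf fibre through `p`, parameterized by `t ↦ p exp (t i)` (of period `2π`). -/
def hopfFibre (p : S3) (t : ℝ) : S3 := p * expI t

end S3

end

/-!
The sphere `S³` is parallelized by the left invariant fields, so tangent vectors are encoded by the
Maurer–Cartan form `S3.mc p v = p⁻¹ v`, an imaginary quaternion, and vector fields and fields along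
curves become functions with values in the Lie algebra of imaginary quaternions. A metric satisfying
`S3.IsBerger g r B` is the constant form `B (r x₁ y₁ + x₂ y₂ + x₃ y₃)` in these terms; the Berger
metric has `(r, B) = (η², 1)` and the normalized one `(η², η²)`.

The Koszul formula on the Lie algebra gives a bilinear map `S3.christoffel r` with
`mc (∇_v Y) = d(mc Y)(v) + christoffel r (mc v) (mc Y)`. This is a Levi-Civita connection, and such
a connection is unique on differentiable fields (`IsLeviCivita.unique`), so it computes the one chosen
in the definitions. Curvature and the derivative along curves then become polynomial expressions in
the Lie algebra. With the cross product `n = x × y` of the two encoded vectors,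
`sec = ((4 - 3 r) n₁² + r² (n₂² + n₃²)) / (B (n₁² + r (n₂² + n₃²)))`, a weighted mean of
`(4 - 3 r) / B` and `r / B`, which gives all the curvature assertions.

*Jacobi fields.* The component `a` of a unit speed geodesic in the direction `i` is constant. The
Hopf field `p ↦ p i` is a Killing field, so its part normal to the geodesic is a Jacobi field. It
has no zeros unless the geodesic is a Hopf fibre, and it spans with the velocity a plane that
contains `i`, of curvature `r / B = 1`. Along a Hopf fibre every plane containing the velocity
contains `i`, and a normal field rotating with unit speed relative to parallel ones is a Jacobi
field.

*No local symmetry.* A local isometry preserves the connection, hence the curvature tensor. If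
`r ≠ 1`, the plane spanned by `j` and `k` is the only one of curvature `(4 - 3 r) / B`, so the
isometry preserves the distribution orthogonal to the Hopf fibres. A map with differential `-id` at
a point preserves `j` and `k` up to sign there but reverses `i`, while `∇_j k` has a nonzero
component in the direction `i`; differentiating the preserved distribution gives a contradiction
(`S3.IsBerger.not_isLocallySymmetricMetric`).

*Simple connectedness.* A loop in a sphere is homotopic to the radial projection of a `C¹` loop in
the ambient space. The cone over the latter is a `C¹` image of a plane and misses some direction
once the ambient dimension is at least three. The sphere without that point is homeomorphic to a vector
space by stereographic projection, so the loop is null homotopic.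
-/

noncomputable section

/-! ### Calculus of vector fields and uniqueness of the Levi-Civita connection -/

section Calculus

variable {E : Type*} [NormedAddCommGroup E] [NormedSpace ℝ E]
  {H : Type*} [TopologicalSpace H] {I : ModelWithCorners ℝ E H}
  {M : Type*} [TopologicalSpace M] [ChartedSpace H M]
  {F F₁ F₂ : Type*} [NormedAddCommGroup F] [NormedSpace ℝ F]
  [NormedAddCommGroup F₁] [NormedSpace ℝ F₁] [NormedAddCommGroup F₂] [NormedSpace ℝ F₂]

theorem hasMFDerivAt_bilinear (B : F₁ →L[ℝ] F₂ →L[ℝ] F) {f : M → F₁} {g : M → F₂} {x : M}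
    (hf : MDifferentiableAt I 𝓘(ℝ, F₁) f x) (hg : MDifferentiableAt I 𝓘(ℝ, F₂) g x) :
    HasMFDerivAt I 𝓘(ℝ, F) (fun q ↦ B (f q) (g q)) x
      (B (f x) ∘L mvfderiv I g x + B.flip (g x) ∘L mvfderiv I f x) := by
  have h := B.hasFDerivWithinAt_of_bilinear hf.hasMFDerivAt.2 hg.hasMFDerivAt.2
  refine ⟨?_, ?_⟩
  · exact ContinuousAt.comp (g := fun z : F₁ × F₂ ↦ B z.1 z.2) B.continuous₂.continuousAt
      (hf.continuousAt.prodMk hg.continuousAt)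
  · convert! h using 1
    simp
    rfl

theorem MDifferentiableAt.bilinear (B : F₁ →L[ℝ] F₂ →L[ℝ] F) {f : M → F₁} {g : M → F₂} {x : M}
    (hf : MDifferentiableAt I 𝓘(ℝ, F₁) f x) (hg : MDifferentiableAt I 𝓘(ℝ, F₂) g x) :
    MDifferentiableAt I 𝓘(ℝ, F) (fun q ↦ B (f q) (g q)) x :=
  (hasMFDerivAt_bilinear B hf hg).mdifferentiableAt

theorem mvfderiv_bilinear (B : F₁ →L[ℝ] F₂ →L[ℝ] F) {f : M → F₁} {g : M → F₂} {x : M}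
    (hf : MDifferentiableAt I 𝓘(ℝ, F₁) f x) (hg : MDifferentiableAt I 𝓘(ℝ, F₂) g x)
    (v : TangentSpace I x) :
    mvfderiv I (fun q ↦ B (f q) (g q)) x v
      = B (mvfderiv I f x v) (g x) + B (f x) (mvfderiv I g x v) := by
  have h := (hasMFDerivAt_bilinear B hf hg).mfderiv
  rw [mvfderiv, h, add_comm]
  rfl

theorem mvfderiv_clm_comp (L : F₁ →L[ℝ] F) {f : M → F₁} {x : M}
    (hf : MDifferentiableAt I 𝓘(ℝ, F₁) f x) (v : TangentSpace I x) :
    mvfderiv I (fun q ↦ L (f q)) x v = L (mvfderiv I f x v) := by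
  have h := mfderiv_comp x (L.differentiableAt (x := f x)).mdifferentiableAt hf
  have h2 : mfderiv 𝓘(ℝ, F₁) 𝓘(ℝ, F) L (f x) = L := by
    rw [mfderiv_eq_fderiv]; exact L.fderiv
  rw [h2] at h
  rw [mvfderiv]
  change (mfderiv I 𝓘(ℝ, F) (L ∘ f) x) v = _
  rw [h]
  rfl

theorem mvfderiv_congr {f g : M → F} {x : M} (h : f =ᶠ[nhds x] g) (v : TangentSpace I x) :
    mvfderiv I f x v = mvfderiv I g x v := by
  change mfderiv I 𝓘(ℝ, F) f x v = mfderiv I 𝓘(ℝ, F) g x v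
  rw [h.mfderiv_eq]
  rfl

variable [IsManifold I ∞ M]

theorem ContMDiffAt.mvfderiv_apply {f : M → F} {x : M} {V : Π x : M, TangentSpace I x}
    {m n : ℕ∞ω} (hf : ContMDiffAt I 𝓘(ℝ, F) n f x)
    (hV : ContMDiffAt I I.tangent m (fun y ↦ (⟨y, V y⟩ : TangentBundle I M)) x)
    (hmn : m + 1 ≤ n) :
    ContMDiffAt I 𝓘(ℝ, F) m (fun q ↦ mvfderiv I f q (V q)) x := by
  have : IsManifold I 1 M := IsManifold.of_le (n := ∞) ENat.LEInfty.out
  have h := hf.mfderiv_const hmn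
  have h2 := ContMDiffAt.clm_apply_of_inCoordinates (b₁ := id) (b₂ := f)
    (E₂ := TangentSpace 𝓘(ℝ, F)) (v := V)
    h hV (hf.of_le (le_self_add.trans hmn))
  exact (contMDiff_snd_tangentBundle_modelSpace F 𝓘(ℝ, F)).contMDiffAt.comp x h2

theorem MDifferentiableAt.mvfderiv_apply {f : M → F} {x : M} {V : Π x : M, TangentSpace I x}
    (hf : ContMDiffAt I 𝓘(ℝ, F) 2 f x)
    (hV : MDifferentiableAt I I.tangent (fun y ↦ (⟨y, V y⟩ : TangentBundle I M)) x) :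
    MDifferentiableAt I 𝓘(ℝ, F) (fun q ↦ mvfderiv I f q (V q)) x := by
  have : IsManifold I 1 M := IsManifold.of_le (n := ∞) ENat.LEInfty.out
  have h := (hf.mfderiv_const (m := 1) (by norm_num)).mdifferentiableAt one_ne_zero
  have h2 := MDifferentiableAt.clm_apply_of_inCoordinates (b₁ := id) (b₂ := f)
    (E₂ := TangentSpace 𝓘(ℝ, F)) (v := V)
    h hV (hf.mdifferentiableAt two_ne_zero)
  exact ((contMDiff_snd_tangentBundle_modelSpace (n := 1) F
    𝓘(ℝ, F)).contMDiffAt.mdifferentiableAt one_ne_zero).comp x h2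

open VectorField in
/-- A vector field acts on a vector valued function by the differential; the Lie bracket acts as
the commutator. The fields only need to be differentiable at the point. -/
theorem mvfderiv_mlieBracket [CompleteSpace E] [I.Boundaryless] {f : M → F} {x : M}
    {U V : Π x : M, TangentSpace I x} (hf : ContMDiffAt I 𝓘(ℝ, F) 2 f x)
    (hU : MDifferentiableAt I I.tangent (fun y ↦ (⟨y, U y⟩ : TangentBundle I M)) x)
    (hV : MDifferentiableAt I I.tangent (fun y ↦ (⟨y, V y⟩ : TangentBundle I M)) x) :
    mvfderiv I f x (mlieBracket I U V x)
      = mvfderiv I (fun q ↦ mvfderiv I f q (V q)) x (U x)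
        - mvfderiv I (fun q ↦ mvfderiv I f q (U q)) x (V x) := by
  have : IsManifold I 2 M := IsManifold.of_le (n := ∞) ENat.LEInfty.out
  have : IsManifold I 1 M := IsManifold.of_le (n := ∞) ENat.LEInfty.out
  set φ := extChartAt I x with hφ
  set P : (Π x : M, TangentSpace I x) → E → E :=
    fun W ↦ mpullbackWithin 𝓘(ℝ, E) I φ.symm W (Set.range I) with hP
  -- the differential of a function in the chart
  have key : ∀ (h : M → F) (W : Π x : M, TangentSpace I x) (y : E), y ∈ φ.target →
      MDifferentiableAt I 𝓘(ℝ, F) h (φ.symm y) →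
      mvfderiv I h (φ.symm y) (W (φ.symm y)) = fderiv ℝ (h ∘ φ.symm) y (P W y) := by
    intro h W y hy hh
    have h1 := mdifferentiableWithinAt_extChartAt_symm (I := I) (x := x) hy
    have hinv := isInvertible_mfderivWithin_extChartAt_symm (I := I) (x := x) hy
    have h2 := mfderiv_comp_mfderivWithin y hh h1
      (I.uniqueMDiffOn y (by rw [I.range_eq_univ]; trivial))
    have h3 : (mfderivWithin 𝓘(ℝ, E) I φ.symm (Set.range I) y) (P W y) = W (φ.symm y) := by
      simp only [hP, mpullbackWithin_apply]
      exact hinv.self_apply_inverse _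
    rw [← h3, mvfderiv]
    rw [I.range_eq_univ, mfderivWithin_univ, mfderiv_eq_fderiv] at h2
    rw [h2, ← I.range_eq_univ]
    rfl
  have hx : φ x ∈ φ.target := mem_extChartAt_target x
  have hsx : φ.symm (φ x) = x := extChartAt_to_inv x
  have hnhds : φ.target ∈ nhds (φ x) := extChartAt_target_mem_nhds x
  have hf' : ContDiffAt ℝ 2 (f ∘ φ.symm) (φ x) := by
    have := (contMDiffAt_iff.1 hf).2
    rw [I.range_eq_univ, contDiffWithinAt_univ] at this
    exact this
  have hcont : Filter.Tendsto φ.symm (nhds (φ x)) (nhds x) := by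
    have := continuousAt_extChartAt_symm (I := I) x
    rw [ContinuousAt, extChartAt_to_inv] at this
    exact this
  have hev : ∀ᶠ q in nhds x, MDifferentiableAt I 𝓘(ℝ, F) f q := by
    filter_upwards [(contMDiffAt_iff_contMDiffAt_nhds (by simp)).1 hf] with q hq
    exact hq.mdifferentiableAt two_ne_zero
  have hP' : ∀ W : Π x : M, TangentSpace I x,
      MDifferentiableAt I I.tangent (fun y ↦ (⟨y, W y⟩ : TangentBundle I M)) x →
      DifferentiableAt ℝ (P W) (φ x) := by
    intro W hW
    have := (mdifferentiableWithinAt_univ.2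
      hW).differentiableWithinAt_mpullbackWithin_vectorField
    exact this.differentiableAt (by simp [I.range_eq_univ])
  have second : ∀ W Z : Π x : M, TangentSpace I x,
      MDifferentiableAt I I.tangent (fun y ↦ (⟨y, W y⟩ : TangentBundle I M)) x →
      mvfderiv I (fun q ↦ mvfderiv I f q (W q)) x (Z x)
        = fderiv ℝ (fderiv ℝ (f ∘ φ.symm)) (φ x) (P Z (φ x)) (P W (φ x))
          + fderiv ℝ (f ∘ φ.symm) (φ x) (fderiv ℝ (P W) (φ x) (P Z (φ x))) := by
    intro W Z hW
    have h0 := key (fun q ↦ mvfderiv I f q (W q)) Z (φ x) hx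
      (by rw [hsx]; exact MDifferentiableAt.mvfderiv_apply hf hW)
    rw [hsx] at h0
    rw [h0]
    have h1 : (fun q ↦ mvfderiv I f q (W q)) ∘ φ.symm
        =ᶠ[nhds (φ x)] fun y ↦ fderiv ℝ (f ∘ φ.symm) y (P W y) := by
      filter_upwards [hnhds, hcont.eventually hev] with y hy hy'
      exact key f W y hy hy'
    rw [h1.fderiv_eq, fderiv_clm_apply ?_ (hP' W hW)]
    · simp [add_comm]
    · exact (hf'.fderiv_right (m := 1) (by norm_num)).differentiableAt one_ne_zero
  rw [second V U hV, second U V hU]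
  have hsymm := hf'.isSymmSndFDerivAt (by simp)
  rw [hsymm.eq (P U (φ x)) (P V (φ x))]
  -- the differential of `f` in terms of the chart
  have h4 : ∀ L : E, mvfderiv I f x ((mfderiv I 𝓘(ℝ, E) φ x).inverse L)
      = fderiv ℝ (f ∘ φ.symm) (φ x) L := by
    intro L
    have e : f =ᶠ[nhds x] (f ∘ φ.symm) ∘ φ := by
      filter_upwards [extChartAt_source_mem_nhds (I := I) x] with q hq
      exact congrArg f ((extChartAt I x).left_inv hq).symm
    have hd := (hf'.differentiableAt two_ne_zero).mdifferentiableAt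
    have h5 := mfderiv_comp x hd (mdifferentiableAt_extChartAt (I := I) (mem_chart_source H x))
    have h6 := (isInvertible_mfderiv_extChartAt (I := I)
      (mem_extChartAt_source (I := I) x)).self_apply_inverse L
    rw [mvfderiv_congr e, mvfderiv]
    change mfderiv I 𝓘(ℝ, F) ((f ∘ φ.symm) ∘ φ) x _ = _
    rw [h5]
    change mfderiv 𝓘(ℝ, E) 𝓘(ℝ, F) (f ∘ φ.symm) (φ x) (mfderiv I 𝓘(ℝ, E) φ x _) = _
    rw [h6, mfderiv_eq_fderiv]
    rfl
  have h7 : mlieBracket I U V x = (mfderiv I 𝓘(ℝ, E) φ x).inverse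
      (fderiv ℝ (P V) (φ x) (P U (φ x)) - fderiv ℝ (P U) (φ x) (P V (φ x))) := by
    rw [← mlieBracketWithin_univ, mlieBracketWithin_apply, Set.preimage_univ, Set.univ_inter,
      ← fderivWithin_univ, ← fderivWithin_univ, ← I.range_eq_univ]
    rfl
  rw [h7, h4, map_sub]
  abel

/-- The fundamental lemma of Riemannian geometry, uniqueness part: two Levi-Civita connections of
the same metric agree on vector fields that are differentiable at the given point. -/
theorem IsLeviCivita.unique [FiniteDimensional ℝ E] {g : SmoothMetric I M}
    {cov cov' : (Π x : M, TangentSpace I x) → Π x : M, TangentSpace I x →L[ℝ] TangentSpace I x}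
    (h : IsLeviCivita g cov) (h' : IsLeviCivita g cov') {Y : Π x : M, TangentSpace I x} {x : M}
    (hY : MDifferentiableAt I I.tangent (fun y ↦ (⟨y, Y y⟩ : TangentBundle I M)) x)
    (v : TangentSpace I x) : cov Y x v = cov' Y x v := by
  have : IsManifold I 1 M := IsManifold.of_le (n := ∞) ENat.LEInfty.out
  set D : (Π x : M, TangentSpace I x) → (Π x : M, TangentSpace I x) → TangentSpace I x :=
    fun X Y ↦ cov Y x (X x) - cov' Y x (X x) with hD
  have hsymm : ∀ X Y : Π x : M, TangentSpace I x,
      MDifferentiableAt I I.tangent (fun y ↦ (⟨y, X y⟩ : TangentBundle I M)) x →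
      MDifferentiableAt I I.tangent (fun y ↦ (⟨y, Y y⟩ : TangentBundle I M)) x →
      D X Y = D Y X := by
    intro X Y hX hY
    have e := (h.torsion_free X Y x hX hY).trans (h'.torsion_free X Y x hX hY).symm
    simp only [hD]
    rw [sub_eq_sub_iff_sub_eq_sub] at e
    exact e
  have hskew : ∀ X Y Z : Π x : M, TangentSpace I x,
      MDifferentiableAt I I.tangent (fun y ↦ (⟨y, Y y⟩ : TangentBundle I M)) x →
      MDifferentiableAt I I.tangent (fun y ↦ (⟨y, Z y⟩ : TangentBundle I M)) x →
      g.inner x (D X Y) (Z x) = - g.inner x (D X Z) (Y x) := by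
    intro X Y Z hY hZ
    have e := (h.metric_compatible Y Z x hY hZ (X x)).symm.trans
      (h'.metric_compatible Y Z x hY hZ (X x))
    simp only [hD, map_sub, sub_apply]
    rw [g.symm x _ (Y x), g.symm x _ (Y x)]
    linarith
  -- the difference tensor is symmetric in the first and skew in the last two arguments
  have key : ∀ X Y Z : Π x : M, TangentSpace I x,
      MDifferentiableAt I I.tangent (fun y ↦ (⟨y, X y⟩ : TangentBundle I M)) x →
      MDifferentiableAt I I.tangent (fun y ↦ (⟨y, Y y⟩ : TangentBundle I M)) x →
      MDifferentiableAt I I.tangent (fun y ↦ (⟨y, Z y⟩ : TangentBundle I M)) x →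
      g.inner x (D X Y) (Z x) = 0 := by
    intro X Y Z hX hY hZ
    have e1 := hskew X Y Z hY hZ
    have e2 := hskew Z X Y hX hY
    have e3 := hskew Y Z X hZ hX
    rw [hsymm X Z hX hZ] at e1
    rw [hsymm Z Y hZ hY] at e2
    rw [hsymm Y X hY hX] at e3
    linarith
  have hext := fun w : TangentSpace I x ↦ FiberBundle.mdifferentiableAt_extend I E w
  have e : D (FiberBundle.extend E v) Y = 0 := by
    by_contra hne
    have h1 := key (FiberBundle.extend E v) Y
      (FiberBundle.extend E (D (FiberBundle.extend E v) Y)) (hext _) hY (hext _)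
    rw [FiberBundle.extend_apply_self] at h1
    exact (g.pos x _ hne).ne' h1
  simpa [hD, sub_eq_zero] using e

/-- If a metric has a Levi-Civita connection then `leviCivita` is one. -/
theorem IsLeviCivita.isLeviCivita_leviCivita {g : SmoothMetric I M}
    {cov : (Π x : M, TangentSpace I x) → Π x : M, TangentSpace I x →L[ℝ] TangentSpace I x}
    (h : IsLeviCivita g cov) : IsLeviCivita g (leviCivita g) :=
  Classical.epsilon_spec ⟨cov, h⟩

end Calculus

/-! ### The Maurer–Cartan form of the three-sphere -/

namespace S3

theorem star_mul_self (p : S3) : star (p : ℍ[ℝ]) * (p : ℍ[ℝ]) = 1 := by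
  have h : ‖(p : ℍ[ℝ])‖ = 1 := by simp
  rw [Quaternion.star_mul_self, Quaternion.normSq_eq_norm_mul_self, h]; simp

theorem mul_star_self (p : S3) : (p : ℍ[ℝ]) * star (p : ℍ[ℝ]) = 1 := by
  have h : ‖(p : ℍ[ℝ])‖ = 1 := by simp
  rw [Quaternion.self_mul_star, Quaternion.normSq_eq_norm_mul_self, h]; simp

/-- The Maurer–Cartan form of `S³`: the tangent vector `v` at `p` is sent to the quaternion
`p⁻¹ v`, which is purely imaginary. -/
def mc (p : S3) : TangentSpace (𝓡 3) p →L[ℝ] ℍ[ℝ] :=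
  ContinuousLinearMap.mul ℝ ℍ[ℝ] (star (p : ℍ[ℝ])) ∘L incl p

theorem mc_apply (p : S3) (v : TangentSpace (𝓡 3) p) :
    mc p v = star (p : ℍ[ℝ]) * incl p v := rfl

theorem coe_mul_mc (p : S3) (v : TangentSpace (𝓡 3) p) : (p : ℍ[ℝ]) * mc p v = incl p v := by
  rw [mc_apply, ← mul_assoc, mul_star_self, one_mul]

theorem mc_eq_iff (p : S3) (v : TangentSpace (𝓡 3) p) (u : ℍ[ℝ]) :
    mc p v = u ↔ incl p v = (p : ℍ[ℝ]) * u := by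
  rw [← coe_mul_mc]
  constructor
  · rintro rfl; rfl
  · intro h
    have := congrArg (star (p : ℍ[ℝ]) * ·) h
    simpa [← mul_assoc, star_mul_self] using this

theorem mc_injective (p : S3) : Function.Injective (mc p) := by
  intro v w h
  have h' : incl p v = incl p w := by rw [← coe_mul_mc, h, coe_mul_mc]
  exact injective_mvfderiv_subtypeVal_sphere (E := ℍ[ℝ]) (n := 3) p h'

theorem inner_coe_mul (p : S3) (u w : ℍ[ℝ]) :
    inner ℝ ((p : ℍ[ℝ]) * u) w = inner ℝ u (star (p : ℍ[ℝ]) * w) := by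
  simp [Quaternion.inner_def]; ring

/-- A tangent vector at `p` is orthogonal to `p`, so that `p⁻¹ v` is imaginary. -/
theorem re_mc (p : S3) (v : TangentSpace (𝓡 3) p) : (mc p v).re = 0 := by
  have h : incl p v ∈ (mvfderiv (𝓡 3) (Subtype.val : S3 → ℍ[ℝ]) p).range := ⟨v, rfl⟩
  rw [range_mvfderiv_subtypeVal] at h
  have h2 := Submodule.mem_orthogonal_singleton_iff_inner_right.1 h
  have h3 := inner_coe_mul p 1 (incl p v)
  rw [mul_one, h2] at h3
  have h4 : (star (p : ℍ[ℝ]) * incl p v).re = 0 := by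
    simp only [Quaternion.inner_def, one_mul, Quaternion.re_star] at h3
    exact h3.symm
  exact h4

theorem exists_mc_eq (p : S3) {u : ℍ[ℝ]} (hu : u.re = 0) : ∃ v, mc p v = u := by
  have h : (p : ℍ[ℝ]) * u ∈ (mvfderiv (𝓡 3) (Subtype.val : S3 → ℍ[ℝ]) p).range := by
    rw [range_mvfderiv_subtypeVal]
    refine Submodule.mem_orthogonal_singleton_iff_inner_right.2 ?_
    have h3 := inner_coe_mul p 1 ((p : ℍ[ℝ]) * u)
    rw [mul_one, ← mul_assoc, star_mul_self, one_mul] at h3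
    rw [h3]
    simp [Quaternion.inner_def, hu]
  obtain ⟨v, hv⟩ := h
  exact ⟨v, (mc_eq_iff p v u).2 hv⟩

theorem coframe_apply (u : ℍ[ℝ]) (p : S3) (v : TangentSpace (𝓡 3) p) :
    coframe u p v = inner ℝ u (mc p v) :=
  inner_coe_mul p u (incl p v)

theorem contMDiff_mul : ContMDiff ((𝓡 3).prod (𝓡 3)) (𝓡 3) ∞ (fun z : S3 × S3 ↦ z.1 * z.2) := by
  have h : ContMDiff ((𝓡 3).prod (𝓡 3)) 𝓘(ℝ, ℍ[ℝ]) ∞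
      (fun z : S3 × S3 ↦ (z.1 : ℍ[ℝ]) * (z.2 : ℍ[ℝ])) := by
    have h2 : ContDiff ℝ ∞ (fun z : ℍ[ℝ] × ℍ[ℝ] ↦ z.1 * z.2) := contDiff_mul
    exact h2.contMDiff.comp ((contMDiff_coe_sphere.comp contMDiff_fst).prodMk_space
      (contMDiff_coe_sphere.comp contMDiff_snd))
  exact h.codRestrict_sphere (fun z ↦ (z.1 * z.2).2)

/-- The imaginary part of a quaternion as a linear map. -/
def imPart : ℍ[ℝ] →ₗ[ℝ] ℍ[ℝ] where
  toFun u := u.im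
  map_add' u v := by ext <;> simp
  map_smul' c u := by ext <;> simp

theorem imPart_of_re {u : ℍ[ℝ]} (hu : u.re = 0) : imPart u = u := by
  ext <;> simp [imPart, hu]

theorem exists_frame (p : S3) : ∃ L : ℍ[ℝ] →L[ℝ] TangentSpace (𝓡 3) p,
    ∀ u, mc p (L u) = imPart u := by
  obtain ⟨L, hL⟩ := (mc p).toLinearMap.exists_leftInverse_of_injective
    (LinearMap.ker_eq_bot.2 (mc_injective p))
  refine ⟨LinearMap.toContinuousLinearMap (L ∘ₗ imPart), fun u ↦ ?_⟩
  obtain ⟨v, hv⟩ := exists_mc_eq p (u := imPart u) (by simp [imPart])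
  have h : L (mc p v) = v := LinearMap.congr_fun hL v
  simp [← hv, h]

/-- The left invariant framing: `frame p u` is the tangent vector `p u` for imaginary `u`, and real
quaternions are sent to zero. -/
def frame (p : S3) : ℍ[ℝ] →L[ℝ] TangentSpace (𝓡 3) p :=
  (exists_frame p).choose

theorem mc_frame' (p : S3) (u : ℍ[ℝ]) : mc p (frame p u) = imPart u :=
  (exists_frame p).choose_spec u

theorem mc_frame (p : S3) {u : ℍ[ℝ]} (hu : u.re = 0) : mc p (frame p u) = u := by
  rw [mc_frame', imPart_of_re hu]

theorem frame_mc (p : S3) (v : TangentSpace (𝓡 3) p) : frame p (mc p v) = v :=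
  mc_injective p (mc_frame p (re_mc p v))

theorem incl_frame (p : S3) (u : ℍ[ℝ]) : incl p (frame p u) = (p : ℍ[ℝ]) * imPart u := by
  rw [← coe_mul_mc, mc_frame']

/-- The tangent bundle embeds into `ℍ × ℍ`; this avoids casts between tangent spaces at points that
are only propositionally equal. -/
theorem tangentBundle_ext {z z' : TangentBundle (𝓡 3) S3} (h : z.1 = z'.1)
    (h' : incl z.1 z.2 = incl z'.1 z'.2) : z = z' := by
  obtain ⟨p, v⟩ := z
  obtain ⟨q, w⟩ := z'
  obtain rfl : p = q := h
  have e : v = w := mc_injective p (by rw [mc_apply, mc_apply, h'])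
  rw [e]

theorem contMDiff_coe : ContMDiff (𝓡 3) 𝓘(ℝ, ℍ[ℝ]) ∞ ((↑) : S3 → ℍ[ℝ]) :=
  contMDiff_coe_sphere (E := ℍ[ℝ]) (n := 3)

theorem incl_mfderiv_mul (p q : S3) (v : TangentSpace (𝓡 3) q) :
    incl (p * q) (mfderiv (𝓡 3) (𝓡 3) (fun q : S3 ↦ p * q) q v) = (p : ℍ[ℝ]) * incl q v := by
  have hm : MDifferentiableAt (𝓡 3) (𝓡 3) (fun q : S3 ↦ p * q) q :=
    (contMDiff_mul.comp (contMDiff_const.prodMk contMDiff_id)).mdifferentiableAt (by simp)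
  have h1 := mvfderiv_clm_comp (I := 𝓡 3) (ContinuousLinearMap.mul ℝ ℍ[ℝ] (p : ℍ[ℝ]))
    ((contMDiff_coe q).mdifferentiableAt (by simp)) v
  have h2 := mfderiv_comp_apply q ((contMDiff_coe (p * q)).mdifferentiableAt (by simp)) hm v
  exact h2.symm.trans h1

/-- Smoothness at the single point `1`, from which the other points are reached by left
translation. -/
theorem contMDiff_frame_one : ContMDiff 𝓘(ℝ, ℍ[ℝ]) (𝓡 3).tangent ∞
    (fun u : ℍ[ℝ] ↦ (⟨1, frame 1 u⟩ : TangentBundle (𝓡 3) S3)) := by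
  intro u
  rw [contMDiffAt_totalSpace]
  refine ⟨contMDiffAt_const, ?_⟩
  have := ((trivializationAt (EuclideanSpace ℝ (Fin 3)) (TangentSpace (𝓡 3))
    (1 : S3)).continuousLinearMapAt ℝ 1 ∘L frame 1).contMDiff (n := ∞)
  refine (this.congr fun u ↦ ?_) u
  simp [Trivialization.linearMapAt_apply]

theorem contMDiff_mfderiv_mul : ContMDiff ((𝓡 3).prod 𝓘(ℝ, ℍ[ℝ])) (𝓡 3).tangent ∞
    (fun z : S3 × ℍ[ℝ] ↦ (⟨z.1 * 1, mfderiv (𝓡 3) (𝓡 3) (fun q : S3 ↦ z.1 * q) 1 (frame 1 z.2)⟩ :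
      TangentBundle (𝓡 3) S3)) := by
  intro z
  have h0 : ContMDiff (((𝓡 3).prod 𝓘(ℝ, ℍ[ℝ])).prod (𝓡 3)) (𝓡 3) ∞
      (fun w : (S3 × ℍ[ℝ]) × S3 ↦ w.1.1 * w.2) :=
    contMDiff_mul.comp ((contMDiff_fst.comp contMDiff_fst).prodMk contMDiff_snd)
  have h1 := ContMDiffAt.mfderiv (m := ∞) (n := ∞) (x₀ := z) (I := 𝓡 3) (I' := 𝓡 3)
    (J := (𝓡 3).prod 𝓘(ℝ, ℍ[ℝ]))
    (fun (w : S3 × ℍ[ℝ]) (q : S3) ↦ w.1 * q) (fun _ ↦ 1) h0.contMDiffAt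
    contMDiffAt_const (by simp)
  have h2 : ContMDiffAt ((𝓡 3).prod 𝓘(ℝ, ℍ[ℝ])) (𝓡 3).tangent ∞
    (fun w : S3 × ℍ[ℝ] ↦ (⟨1, frame 1 w.2⟩ : TangentBundle (𝓡 3) S3)) z :=
    (contMDiff_frame_one.comp contMDiff_snd) z
  have h3 : ContMDiffAt ((𝓡 3).prod 𝓘(ℝ, ℍ[ℝ])) (𝓡 3) ∞ (fun w : S3 × ℍ[ℝ] ↦ w.1 * 1) z :=
    (contMDiff_mul.comp (contMDiff_fst.prodMk contMDiff_const)) z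
  refine ContMDiffAt.clm_apply_of_inCoordinates (IM := (𝓡 3).prod 𝓘(ℝ, ℍ[ℝ]))
    (IB₁ := 𝓡 3) (IB₂ := 𝓡 3) (F₁ := EuclideanSpace ℝ (Fin 3))
    (F₂ := EuclideanSpace ℝ (Fin 3)) (E₁ := TangentSpace (𝓡 3) (M := S3))
    (E₂ := TangentSpace (𝓡 3) (M := S3)) (b₁ := fun _ ↦ (1 : S3))
    (b₂ := fun w : S3 × ℍ[ℝ] ↦ w.1 * 1) (v := fun w ↦ frame 1 w.2)
    (ϕ := fun w ↦ mfderiv (𝓡 3) (𝓡 3) (fun q : S3 ↦ w.1 * q) 1) ?_ ?_ ?_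
  · exact h1
  · exact h2
  · exact h3

/-- Left multiplication is smooth in both variables, so the framing obtained by translating the
tangent space at `1` is smooth. -/
theorem contMDiff_frame : ContMDiff ((𝓡 3).prod 𝓘(ℝ, ℍ[ℝ])) (𝓡 3).tangent ∞
    (fun z : S3 × ℍ[ℝ] ↦ (⟨z.1, frame z.1 z.2⟩ : TangentBundle (𝓡 3) S3)) := by
  have e : (fun z : S3 × ℍ[ℝ] ↦ (⟨z.1, frame z.1 z.2⟩ : TangentBundle (𝓡 3) S3))
      = fun z ↦ ⟨z.1 * 1, mfderiv (𝓡 3) (𝓡 3) (fun q : S3 ↦ z.1 * q) 1 (frame 1 z.2)⟩ := by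
    funext z
    refine tangentBundle_ext (mul_one z.1).symm ?_
    rw [incl_mfderiv_mul, incl_frame, incl_frame]
    simp
  rw [e]
  exact contMDiff_mfderiv_mul

end S3

/-! ### The Levi-Civita connection of a Berger metric -/

namespace S3

/-- The imaginary quaternion with components `a`, `b`, `c`. -/
def mkIm (a b c : ℝ) : ℍ[ℝ] := ⟨0, a, b, c⟩

@[simp] theorem re_mkIm (a b c : ℝ) : (mkIm a b c).re = 0 := rfl
@[simp] theorem imI_mkIm (a b c : ℝ) : (mkIm a b c).imI = a := rfl
@[simp] theorem imJ_mkIm (a b c : ℝ) : (mkIm a b c).imJ = b := rfl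
@[simp] theorem imK_mkIm (a b c : ℝ) : (mkIm a b c).imK = c := rfl

theorem qi_eq : qi = mkIm 1 0 0 := rfl
theorem qj_eq : qj = mkIm 0 1 0 := rfl
theorem qk_eq : qk = mkIm 0 0 1 := rfl

/-- The inner product on imaginary quaternions for which `i`, `j`, `k` are orthogonal with squared
norms `B r`, `B`, `B`, extended by zero to the real quaternions. -/
def leftForm (r B : ℝ) : ℍ[ℝ] →L[ℝ] ℍ[ℝ] →L[ℝ] ℝ :=
  (LinearMap.mk₂ ℝ (fun x y : ℍ[ℝ] ↦ B * (r * (x.imI * y.imI) + x.imJ * y.imJ + x.imK * y.imK))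
    (by intros; simp; ring) (by intros; simp; ring) (by intros; simp; ring)
    (by intros; simp; ring)).toContinuousBilinearMap

theorem leftForm_apply (r B : ℝ) (x y : ℍ[ℝ]) :
    leftForm r B x y = B * (r * (x.imI * y.imI) + x.imJ * y.imJ + x.imK * y.imK) := rfl

/-- The Levi-Civita connection of a left invariant Berger metric, as a bilinear operation on the
Lie algebra of imaginary quaternions. It only depends on the ratio `r` of the squared norms of `i`
and `j`, and it is read off from the Koszul formula with the bracket `[x, y] = x y - y x`. -/
def christoffel (r : ℝ) : ℍ[ℝ] →L[ℝ] ℍ[ℝ] →L[ℝ] ℍ[ℝ] :=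
  (LinearMap.mk₂ ℝ (fun x y : ℍ[ℝ] ↦ mkIm (x.imJ * y.imK - x.imK * y.imJ)
      (r * (x.imK * y.imI) + (r - 2) * (x.imI * y.imK))
      ((2 - r) * (x.imI * y.imJ) - r * (x.imJ * y.imI)))
    (by intros; ext <;> simp <;> ring) (by intros; ext <;> simp <;> ring)
    (by intros; ext <;> simp <;> ring) (by intros; ext <;> simp <;> ring)).toContinuousBilinearMap

theorem christoffel_apply (r : ℝ) (x y : ℍ[ℝ]) :
    christoffel r x y = mkIm (x.imJ * y.imK - x.imK * y.imJ)
      (r * (x.imK * y.imI) + (r - 2) * (x.imI * y.imK))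
      ((2 - r) * (x.imI * y.imJ) - r * (x.imJ * y.imI)) := rfl

theorem christoffel_add_left (r : ℝ) (x y z : ℍ[ℝ]) :
    christoffel r (x + y) z = christoffel r x z + christoffel r y z :=
  (christoffel r).map_add₂ x y z

theorem christoffel_sub_left (r : ℝ) (x y z : ℍ[ℝ]) :
    christoffel r (x - y) z = christoffel r x z - christoffel r y z :=
  (christoffel r).map_sub₂ x y z

theorem christoffel_add_right (r : ℝ) (x y z : ℍ[ℝ]) :
    christoffel r x (y + z) = christoffel r x y + christoffel r x z :=
  map_add _ _ _

/-- The connection `christoffel r` is torsion free. -/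
theorem christoffel_sub_swap (r : ℝ) (x y : ℍ[ℝ]) :
    christoffel r x y - christoffel r y x = x * y - y * x := by
  ext <;> simp [christoffel_apply] <;> ring

/-- The connection `christoffel r` is metric. -/
theorem leftForm_christoffel (r B : ℝ) (x y z : ℍ[ℝ]) :
    leftForm r B (christoffel r x y) z + leftForm r B y (christoffel r x z) = 0 := by
  simp [leftForm_apply, christoffel_apply]; ring

theorem leftForm_comm (r B : ℝ) (x y : ℍ[ℝ]) : leftForm r B x y = leftForm r B y x := by
  simp only [leftForm_apply]; ring

/-- The curvature tensor on the Lie algebra that belongs to `christoffel r`. -/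
def leftCurvature (r : ℝ) (x y z : ℍ[ℝ]) : ℍ[ℝ] :=
  christoffel r x (christoffel r y z) - christoffel r y (christoffel r x z)
    - christoffel r (x * y - y * x) z

theorem re_mvfderiv {f : S3 → ℍ[ℝ]} {x : S3} (h : ∀ᶠ q in nhds x, (f q).re = 0)
    (v : TangentSpace (𝓡 3) x) : (mvfderiv (𝓡 3) f x v).re = 0 := by
  by_cases hf : MDifferentiableAt (𝓡 3) 𝓘(ℝ, ℍ[ℝ]) f x
  · set L : ℍ[ℝ] →L[ℝ] ℝ := innerSL ℝ (1 : ℍ[ℝ]) with hL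
    have hre : ∀ u, L u = u.re := fun u ↦ by simp [hL, Quaternion.inner_def]
    have h1 := mvfderiv_clm_comp L hf v
    have h2 : (fun q ↦ L (f q)) =ᶠ[nhds x] fun _ ↦ 0 := by
      filter_upwards [h] with q hq
      rw [hre, hq]
    rw [mvfderiv_congr h2, mvfderiv_const, hre] at h1
    exact h1.symm
  · rw [mvfderiv, mfderiv_zero_of_not_mdifferentiableAt hf]
    rfl

/-- Quaternionic conjugation as a linear map. -/
def starCLM : ℍ[ℝ] →L[ℝ] ℍ[ℝ] :=
  LinearMap.toContinuousLinearMap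
    { toFun := star, map_add' := star_add, map_smul' := fun c u ↦ by simp }

theorem mdifferentiableAt_mc {V : Π p : S3, TangentSpace (𝓡 3) p} {x : S3}
    (hV : MDifferentiableAt (𝓡 3) (𝓡 3).tangent
      (fun y ↦ (⟨y, V y⟩ : TangentBundle (𝓡 3) S3)) x) :
    MDifferentiableAt (𝓡 3) 𝓘(ℝ, ℍ[ℝ]) (fun q ↦ mc q (V q)) x := by
  have h1 : MDifferentiableAt (𝓡 3) 𝓘(ℝ, ℍ[ℝ]) (fun q ↦ incl q (V q)) x :=
    MDifferentiableAt.mvfderiv_apply (contMDiff_coe_sphere (m := 2) (n := 3) (E := ℍ[ℝ]) x) hV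
  have h2 : MDifferentiableAt (𝓡 3) 𝓘(ℝ, ℍ[ℝ]) (fun q : S3 ↦ star (q : ℍ[ℝ])) x :=
    (starCLM).differentiable.comp_mdifferentiableAt
      ((contMDiff_coe x).mdifferentiableAt (by simp))
  exact MDifferentiableAt.bilinear (ContinuousLinearMap.mul ℝ ℍ[ℝ]) h2 h1

theorem contMDiff_star_coe : ContMDiff (𝓡 3) 𝓘(ℝ, ℍ[ℝ]) ∞ (fun q : S3 ↦ star (q : ℍ[ℝ])) :=
  (starCLM).contDiff.contMDiff.comp contMDiff_coe

theorem contMDiffAt_mc {V : Π p : S3, TangentSpace (𝓡 3) p} {x : S3}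
    (hV : ContMDiffAt (𝓡 3) (𝓡 3).tangent ∞
      (fun y ↦ (⟨y, V y⟩ : TangentBundle (𝓡 3) S3)) x) :
    ContMDiffAt (𝓡 3) 𝓘(ℝ, ℍ[ℝ]) ∞ (fun q ↦ mc q (V q)) x := by
  have h1 : ContMDiffAt (𝓡 3) 𝓘(ℝ, ℍ[ℝ]) ∞ (fun q ↦ incl q (V q)) x :=
    ContMDiffAt.mvfderiv_apply (contMDiff_coe x) hV (by simp)
  have h3 : ContDiff ℝ ∞ (fun z : ℍ[ℝ] × ℍ[ℝ] ↦ z.1 * z.2) := contDiff_mul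
  exact h3.contMDiff.contMDiffAt.comp x ((contMDiff_star_coe x).prodMk_space h1)

/-- The Maurer–Cartan equation. -/
theorem mc_mlieBracket {U V : Π p : S3, TangentSpace (𝓡 3) p} {x : S3}
    (hU : MDifferentiableAt (𝓡 3) (𝓡 3).tangent
      (fun y ↦ (⟨y, U y⟩ : TangentBundle (𝓡 3) S3)) x)
    (hV : MDifferentiableAt (𝓡 3) (𝓡 3).tangent
      (fun y ↦ (⟨y, V y⟩ : TangentBundle (𝓡 3) S3)) x) :
    mc x (VectorField.mlieBracket (𝓡 3) U V x)
      = mvfderiv (𝓡 3) (fun q ↦ mc q (V q)) x (U x)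
        - mvfderiv (𝓡 3) (fun q ↦ mc q (U q)) x (V x)
        + (mc x (U x) * mc x (V x) - mc x (V x) * mc x (U x)) := by
  rw [mc_eq_iff]
  have hd : ∀ {W : Π p : S3, TangentSpace (𝓡 3) p} (_ : MDifferentiableAt (𝓡 3) (𝓡 3).tangent
      (fun y ↦ (⟨y, W y⟩ : TangentBundle (𝓡 3) S3)) x) (v : TangentSpace (𝓡 3) x),
      mvfderiv (𝓡 3) (fun q ↦ mvfderiv (𝓡 3) ((↑) : S3 → ℍ[ℝ]) q (W q)) x v
        = (x : ℍ[ℝ]) * (mc x v * mc x (W x) + mvfderiv (𝓡 3) (fun q ↦ mc q (W q)) x v) := by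
    intro W hW v
    have e : (fun q ↦ mvfderiv (𝓡 3) ((↑) : S3 → ℍ[ℝ]) q (W q))
        = fun q : S3 ↦ ContinuousLinearMap.mul ℝ ℍ[ℝ] (q : ℍ[ℝ]) (mc q (W q)) := by
      funext q
      exact (coe_mul_mc q (W q)).symm
    rw [e, mvfderiv_bilinear _ ((contMDiff_coe x).mdifferentiableAt (by simp))
      (mdifferentiableAt_mc hW)]
    change incl x v * _ + _ = _
    rw [← coe_mul_mc]
    simp [mul_add, mul_assoc]
  have h := mvfderiv_mlieBracket (contMDiff_coe_sphere (m := 2) (n := 3) (E := ℍ[ℝ]) x) hU hV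
  rw [hd hV, hd hU] at h
  refine Eq.trans h ?_
  rw [← mul_sub]
  congr 1
  abel

/-- The explicit Levi-Civita connection of a left invariant Berger metric. -/
def bergerConnection (r : ℝ) (Y : Π p : S3, TangentSpace (𝓡 3) p) (x : S3) :
    TangentSpace (𝓡 3) x →L[ℝ] TangentSpace (𝓡 3) x :=
  frame x ∘L (mvfderiv (𝓡 3) (fun q ↦ mc q (Y q)) x + (christoffel r).flip (mc x (Y x)) ∘L mc x)

theorem mc_bergerConnection (r : ℝ) (Y : Π p : S3, TangentSpace (𝓡 3) p) (x : S3)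
    (v : TangentSpace (𝓡 3) x) :
    mc x (bergerConnection r Y x v)
      = mvfderiv (𝓡 3) (fun q ↦ mc q (Y q)) x v + christoffel r (mc x v) (mc x (Y x)) := by
  have h : (mvfderiv (𝓡 3) (fun q ↦ mc q (Y q)) x v
      + christoffel r (mc x v) (mc x (Y x))).re = 0 := by
    rw [Quaternion.re_add, re_mvfderiv (Filter.Eventually.of_forall fun q ↦ re_mc q _),
      christoffel_apply, re_mkIm, add_zero]
  exact mc_frame x h

/-- `g` is the left invariant metric given by `leftForm r B`. -/
def IsBerger (g : SmoothMetric (𝓡 3) S3) (r B : ℝ) : Prop :=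
  ∀ (p : S3) (v w : TangentSpace (𝓡 3) p), g.inner p v w = leftForm r B (mc p v) (mc p w)

theorem isBerger_bergerMetric (η : ℝ) (hη : 0 < η) : IsBerger (bergerMetric η hη) (η ^ 2) 1 := by
  intro p v w
  change bergerForm η p v w = _
  have hi : ∀ u : ℍ[ℝ], inner ℝ qi u = u.imI := fun u ↦ by simp [Quaternion.inner_def, qi_eq]
  have hj : ∀ u : ℍ[ℝ], inner ℝ qj u = u.imJ := fun u ↦ by simp [Quaternion.inner_def, qj_eq]
  have hk : ∀ u : ℍ[ℝ], inner ℝ qk u = u.imK := fun u ↦ by simp [Quaternion.inner_def, qk_eq]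
  simp [bergerForm, leftForm_apply, coframe_apply, hi, hj, hk]

theorem isBerger_normalizedBergerMetric (η : ℝ) (hη : 0 < η) :
    IsBerger (normalizedBergerMetric η hη) (η ^ 2) (η ^ 2) := by
  intro p v w
  have h := isBerger_bergerMetric η hη p v w
  change η ^ 2 * (bergerMetric η hη).inner p v w = _
  rw [h]
  simp [leftForm_apply]

variable {g : SmoothMetric (𝓡 3) S3} {r B : ℝ}

theorem IsBerger.isLeviCivita_bergerConnection (hg : IsBerger g r B) :
    IsLeviCivita g (bergerConnection r) where
  isCovariantDerivative := by
    constructor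
    · intro Y Z x hY hZ _
      ext1 v
      apply mc_injective x
      rw [add_apply, map_add, mc_bergerConnection, mc_bergerConnection, mc_bergerConnection]
      have h := mvfderiv_add (mdifferentiableAt_mc hY) (mdifferentiableAt_mc hZ)
      have e : (fun q ↦ mc q ((Y + Z) q)) = (fun q ↦ mc q (Y q)) + fun q ↦ mc q (Z q) := by
        funext q; simp
      rw [e, h]
      simp
      abel
    · intro Y f x hY hf _
      ext1 v
      apply mc_injective x
      have h := mvfderiv_smul hf (mdifferentiableAt_mc hY)
      have e : (fun q ↦ mc q ((f • Y) q)) = f • fun q ↦ mc q (Y q) := by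
        funext q; simp
      rw [add_apply, map_add, mc_bergerConnection, e, h]
      simp [mc_bergerConnection]
      abel
  torsion_free X Y x hX hY := by
    apply mc_injective x
    rw [map_sub, mc_bergerConnection, mc_bergerConnection, mc_mlieBracket hX hY,
      ← christoffel_sub_swap r]
    abel
  metric_compatible Y Z x hY hZ v := by
    have e : (fun y ↦ g.inner y (Y y) (Z y))
        = fun y ↦ leftForm r B (mc y (Y y)) (mc y (Z y)) := by
      funext y; exact hg y _ _
    rw [e, mvfderiv_bilinear _ (mdifferentiableAt_mc hY) (mdifferentiableAt_mc hZ), hg, hg,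
      mc_bergerConnection, mc_bergerConnection, map_add, add_apply, map_add]
    have := leftForm_christoffel r B (mc x v) (mc x (Y x)) (mc x (Z x))
    linarith

theorem IsBerger.isLeviCivita (hg : IsBerger g r B) : IsLeviCivita g (leviCivita g) :=
  hg.isLeviCivita_bergerConnection.isLeviCivita_leviCivita

theorem IsBerger.mc_leviCivita (hg : IsBerger g r B) {Y : Π p : S3, TangentSpace (𝓡 3) p} {x : S3}
    (hY : MDifferentiableAt (𝓡 3) (𝓡 3).tangent
      (fun y ↦ (⟨y, Y y⟩ : TangentBundle (𝓡 3) S3)) x) (v : TangentSpace (𝓡 3) x) :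
    mc x (leviCivita g Y x v)
      = mvfderiv (𝓡 3) (fun q ↦ mc q (Y q)) x v + christoffel r (mc x v) (mc x (Y x)) := by
  rw [hg.isLeviCivita.unique hg.isLeviCivita_bergerConnection hY v, mc_bergerConnection]

end S3

/-! ### Curvature and covariant derivatives along curves -/

namespace S3

variable {g : SmoothMetric (𝓡 3) S3} {r B : ℝ}

theorem mdifferentiableAt_frame {f : S3 → ℍ[ℝ]} {x : S3}
    (hf : MDifferentiableAt (𝓡 3) 𝓘(ℝ, ℍ[ℝ]) f x) :
    MDifferentiableAt (𝓡 3) (𝓡 3).tangent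
      (fun y ↦ (⟨y, frame y (f y)⟩ : TangentBundle (𝓡 3) S3)) x := by
  have h := (contMDiff_frame (x, f x)).mdifferentiableAt (by simp)
  have h2 : MDifferentiableAt (𝓡 3) ((𝓡 3).prod 𝓘(ℝ, ℍ[ℝ])) (fun y ↦ (y, f y)) x :=
    mdifferentiableAt_id.prodMk hf
  exact h.comp x h2

/-- The iterated covariant derivative `∇_u ∇_Z W` in the left invariant framing. -/
theorem IsBerger.mc_leviCivita_leviCivita (hg : IsBerger g r B)
    {Z W : Π p : S3, TangentSpace (𝓡 3) p} {x : S3}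
    (hZ : ContMDiffAt (𝓡 3) (𝓡 3).tangent ∞
      (fun y ↦ (⟨y, Z y⟩ : TangentBundle (𝓡 3) S3)) x)
    (hW : ContMDiffAt (𝓡 3) (𝓡 3).tangent ∞
      (fun y ↦ (⟨y, W y⟩ : TangentBundle (𝓡 3) S3)) x) (u : TangentSpace (𝓡 3) x) :
    mc x (leviCivita g (fun y ↦ leviCivita g W y (Z y)) x u)
      = mvfderiv (𝓡 3) (fun q ↦ mvfderiv (𝓡 3) (fun p ↦ mc p (W p)) q (Z q)) x u
        + christoffel r (mvfderiv (𝓡 3) (fun q ↦ mc q (Z q)) x u) (mc x (W x))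
        + christoffel r (mc x (Z x)) (mvfderiv (𝓡 3) (fun q ↦ mc q (W q)) x u)
        + christoffel r (mc x u) (mvfderiv (𝓡 3) (fun q ↦ mc q (W q)) x (Z x)
          + christoffel r (mc x (Z x)) (mc x (W x))) := by
  have hW' : ∀ᶠ y in nhds x, MDifferentiableAt (𝓡 3) (𝓡 3).tangent
      (fun y ↦ (⟨y, W y⟩ : TangentBundle (𝓡 3) S3)) y := by
    filter_upwards [(contMDiffAt_iff_contMDiffAt_nhds (n := 1) (by simp)).1
      (hW.of_le (by simp))] with y hy
    exact hy.mdifferentiableAt (by simp)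
  set n : S3 → ℍ[ℝ] := fun y ↦ mvfderiv (𝓡 3) (fun p ↦ mc p (W p)) y (Z y)
    + christoffel r (mc y (Z y)) (mc y (W y)) with hn
  have hev : ∀ᶠ y in nhds x, mc y (leviCivita g W y (Z y)) = n y := by
    filter_upwards [hW'] with y hy
    exact hg.mc_leviCivita hy _
  have hcW := contMDiffAt_mc hW
  have hZd := hZ.mdifferentiableAt (by simp)
  have hWd := hW.mdifferentiableAt (by simp)
  have hn1 : MDifferentiableAt (𝓡 3) 𝓘(ℝ, ℍ[ℝ])
      (fun y ↦ mvfderiv (𝓡 3) (fun p ↦ mc p (W p)) y (Z y)) x :=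
    MDifferentiableAt.mvfderiv_apply (hcW.of_le (by exact ENat.LEInfty.out)) hZd
  have hn2 := MDifferentiableAt.bilinear (christoffel r) (mdifferentiableAt_mc hZd)
    (mdifferentiableAt_mc hWd)
  have hN : MDifferentiableAt (𝓡 3) (𝓡 3).tangent
      (fun y ↦ (⟨y, leviCivita g W y (Z y)⟩ : TangentBundle (𝓡 3) S3)) x := by
    refine (mdifferentiableAt_frame (hn1.add hn2)).congr_of_eventuallyEq ?_
    filter_upwards [hev] with y hy
    change _ = (⟨y, frame y (n y)⟩ : TangentBundle (𝓡 3) S3)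
    rw [← hy, frame_mc]
  rw [hg.mc_leviCivita hN, hev.self_of_nhds, mvfderiv_congr hev, hn, mvfderiv_fun_add hn1 hn2,
    add_apply, mvfderiv_bilinear _ (mdifferentiableAt_mc hZd) (mdifferentiableAt_mc hWd)]
  abel

/-- The curvature tensor is algebraic: the second derivatives of the extended fields cancel by
`mvfderiv_mlieBracket`, and their first derivatives by the Maurer–Cartan equation. -/
theorem IsBerger.mc_curvatureTensor (hg : IsBerger g r B) (x : S3)
    (u v w : TangentSpace (𝓡 3) x) :
    mc x (curvatureTensor g x u v w) = leftCurvature r (mc x u) (mc x v) (mc x w) := by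
  have : IsManifold (𝓡 3) 1 S3 := IsManifold.of_le (n := ∞) ENat.LEInfty.out
  have hext := fun w : TangentSpace (𝓡 3) x ↦ FiberBundle.contMDiffAt_extend (k := ∞) (𝓡 3)
    (EuclideanSpace ℝ (Fin 3)) w
  have hext' := fun w ↦ (hext w).mdifferentiableAt (by simp)
  have hcW : ContMDiffAt (𝓡 3) 𝓘(ℝ, ℍ[ℝ]) 2 _ x :=
    (contMDiffAt_mc (hext w)).of_le ENat.LEInfty.out
  have hL := mvfderiv_mlieBracket hcW (hext' u) (hext' v)
  have hM := mc_mlieBracket (hext' u) (hext' v)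
  simp only [curvatureTensor, map_sub]
  have h1 := hg.mc_leviCivita_leviCivita (hext v) (hext w) u
  have h2 := hg.mc_leviCivita_leviCivita (hext u) (hext w) v
  have h3 := hg.mc_leviCivita (hext' w) (VectorField.mlieBracket (𝓡 3)
    (FiberBundle.extend (EuclideanSpace ℝ (Fin 3)) u)
    (FiberBundle.extend (EuclideanSpace ℝ (Fin 3)) v) x)
  rw [h1, h2, h3, hL, hM]
  simp only [FiberBundle.extend_apply_self, leftCurvature, christoffel_add_left,
    christoffel_sub_left, christoffel_add_right]
  abel

theorem leftForm_leftCurvature (r B : ℝ) (x y : ℍ[ℝ]) :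
    leftForm r B (leftCurvature r x y y) x
      = B * ((4 - 3 * r) * (x.imJ * y.imK - x.imK * y.imJ) ^ 2
        + r ^ 2 * ((x.imK * y.imI - x.imI * y.imK) ^ 2
          + (x.imI * y.imJ - x.imJ * y.imI) ^ 2)) := by
  rw [leftForm_apply]
  simp only [leftCurvature, christoffel_apply, Quaternion.imI_sub, Quaternion.imJ_sub,
    Quaternion.imK_sub, Quaternion.imI_mul, Quaternion.imJ_mul, Quaternion.imK_mul, imI_mkIm,
    imJ_mkIm, imK_mkIm]
  ring

theorem leftForm_gram (r B : ℝ) (x y : ℍ[ℝ]) :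
    leftForm r B x x * leftForm r B y y - leftForm r B x y ^ 2
      = B ^ 2 * ((x.imJ * y.imK - x.imK * y.imJ) ^ 2
        + r * ((x.imK * y.imI - x.imI * y.imK) ^ 2
          + (x.imI * y.imJ - x.imJ * y.imI) ^ 2)) := by
  rw [leftForm_apply, leftForm_apply, leftForm_apply]
  ring

/-- The sectional curvature of a Berger metric, in terms of the cross product of the two vectors
in the left invariant framing. -/
theorem IsBerger.sectionalCurvature_eq (hg : IsBerger g r B) (p : S3)
    (v w : TangentSpace (𝓡 3) p) :
    sectionalCurvature g p v w
      = B * ((4 - 3 * r) * ((mc p v).imJ * (mc p w).imK - (mc p v).imK * (mc p w).imJ) ^ 2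
        + r ^ 2 * (((mc p v).imK * (mc p w).imI - (mc p v).imI * (mc p w).imK) ^ 2
          + ((mc p v).imI * (mc p w).imJ - (mc p v).imJ * (mc p w).imI) ^ 2))
      / (B ^ 2 * (((mc p v).imJ * (mc p w).imK - (mc p v).imK * (mc p w).imJ) ^ 2
        + r * (((mc p v).imK * (mc p w).imI - (mc p v).imI * (mc p w).imK) ^ 2
          + ((mc p v).imI * (mc p w).imJ - (mc p v).imJ * (mc p w).imI) ^ 2))) := by
  rw [sectionalCurvature, hg, hg, hg, hg, hg.mc_curvatureTensor, leftForm_leftCurvature,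
    leftForm_gram]

/-- The Maurer–Cartan form is smooth as a family of linear maps in a trivialization of the tangent
bundle. -/
theorem contMDiffAt_mc_symmL (p : S3) :
    ContMDiffAt (𝓡 3) 𝓘(ℝ, EuclideanSpace ℝ (Fin 3) →L[ℝ] ℍ[ℝ]) ∞
      (fun q : S3 ↦ mc q ∘L (trivializationAt (EuclideanSpace ℝ (Fin 3))
        (TangentSpace (𝓡 3) (M := S3)) p).symmL ℝ q) p := by
  have h := (contMDiff_coe p).mfderiv_const (m := ∞) le_rfl
  have h1 : ContMDiff (𝓡 3) 𝓘(ℝ, ℍ[ℝ] →L[ℝ] ℍ[ℝ]) ∞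
      (fun q : S3 ↦ ContinuousLinearMap.mul ℝ ℍ[ℝ] (star (q : ℍ[ℝ]))) :=
    (ContinuousLinearMap.mul ℝ ℍ[ℝ]).contDiff.contMDiff.comp contMDiff_star_coe
  refine ((h1 p).clm_comp h).congr_of_eventuallyEq (Filter.Eventually.of_forall fun q ↦ ?_)
  ext1 v
  simp [-mul_eq_mul_left_iff, ContinuousLinearMap.inCoordinates, inTangentCoordinates,
    mc, incl, mvfderiv]
  rfl

set_option synthInstance.maxHeartbeats 200000 in
/-- The covariant derivative along a curve in the left invariant framing. The trivialization `e` of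
the definition enters through `L q = mc q ∘ (e q)⁻¹`; the derivative of `L` along the curve is the
derivative of the local field with constant coordinates, and the two contributions cancel. -/
theorem IsBerger.mc_covDerivAlong (hg : IsBerger g r B) {γ : ℝ → S3}
    {V : Π t : ℝ, TangentSpace (𝓡 3) (γ t)} {t : ℝ}
    (hγ : MDifferentiableAt 𝓘(ℝ, ℝ) (𝓡 3) γ t)
    (hV : DifferentiableAt ℝ (fun τ ↦ mc (γ τ) (V τ)) t) :
    mc (γ t) (covDerivAlong g γ V t) = deriv (fun τ ↦ mc (γ τ) (V τ)) t
      + christoffel r (mc (γ t) (velocity (𝓡 3) γ t)) (mc (γ t) (V t)) := by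
  have : IsManifold (𝓡 3) 1 S3 := IsManifold.of_le (n := ∞) ENat.LEInfty.out
  set e := trivializationAt (EuclideanSpace ℝ (Fin 3)) (TangentSpace (𝓡 3) (M := S3)) (γ t) with he
  set L : S3 → EuclideanSpace ℝ (Fin 3) →L[ℝ] ℍ[ℝ] := fun q ↦ mc q ∘L e.symmL ℝ q with hL
  have hLd : MDifferentiableAt (𝓡 3) 𝓘(ℝ, EuclideanSpace ℝ (Fin 3) →L[ℝ] ℍ[ℝ]) L (γ t) :=
    (contMDiffAt_mc_symmL (γ t)).mdifferentiableAt (by simp)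
  have hbase : ∀ᶠ q in nhds (γ t), q ∈ e.baseSet :=
    e.open_baseSet.mem_nhds (mem_baseSet_trivializationAt _ _ (γ t))
  have hmem : γ t ∈ e.baseSet := hbase.self_of_nhds
  set φ : ℝ → EuclideanSpace ℝ (Fin 3) := fun τ ↦ (e ⟨γ τ, V τ⟩).2 with hφ
  have hLmc : ∀ q ∈ e.baseSet, ∀ v : TangentSpace (𝓡 3) q, L q (e ⟨q, v⟩).2 = mc q v := by
    intro q hq v
    simp only [hL, ContinuousLinearMap.comp_apply]
    rw [Trivialization.symmL_apply _ hq, Trivialization.symm_apply_apply_mk _ hq]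
  -- the coordinates of `V` are differentiable
  have hφd : DifferentiableAt ℝ φ t := by
    have h1 : MDifferentiableAt 𝓘(ℝ, ℝ) ((𝓡 3).prod 𝓘(ℝ, ℍ[ℝ]))
        (fun τ ↦ (γ τ, mc (γ τ) (V τ))) t := hγ.prodMk hV.mdifferentiableAt
    have h2 := MDifferentiableAt.comp t
      ((contMDiff_frame (γ t, mc (γ t) (V t))).mdifferentiableAt (by simp)) h1
    have h3 := ((mdifferentiableAt_totalSpace _ _).1 h2).2.differentiableAt
    refine h3.congr_of_eventuallyEq (Filter.Eventually.of_forall fun τ ↦ ?_)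
    simp only [hφ, Function.comp, frame_mc]
    rfl
  have hLγ : HasDerivAt (fun τ ↦ L (γ τ)) (mvfderiv (𝓡 3) L (γ t) (velocity (𝓡 3) γ t)) t := by
    have h1 := (hLd.comp t hγ).differentiableAt.hasDerivAt
    have h2 := mfderiv_comp_apply t hLd hγ (1 : ℝ)
    rw [mfderiv_eq_fderiv] at h2
    convert! h1 using 1
    exact h2.symm
  have hder : deriv (fun τ ↦ mc (γ τ) (V τ)) t
      = mvfderiv (𝓡 3) L (γ t) (velocity (𝓡 3) γ t) (φ t) + L (γ t) (deriv φ t) := by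
    have h1 : (fun τ ↦ mc (γ τ) (V τ)) =ᶠ[nhds t] fun τ ↦ L (γ τ) (φ τ) := by
      filter_upwards [hγ.continuousAt.eventually hbase] with τ hτ
      exact (hLmc _ hτ _).symm
    rw [h1.deriv_eq, (hLγ.clm_apply hφd.hasDerivAt).deriv]
  have hext : mvfderiv (𝓡 3) (fun q ↦ mc q (FiberBundle.extend (EuclideanSpace ℝ (Fin 3)) (V t) q))
      (γ t) (velocity (𝓡 3) γ t)
      = mvfderiv (𝓡 3) L (γ t) (velocity (𝓡 3) γ t) (φ t) := by
    have h1 : (fun q ↦ mc q (FiberBundle.extend (EuclideanSpace ℝ (Fin 3)) (V t) q))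
        =ᶠ[nhds (γ t)] fun q ↦ ContinuousLinearMap.apply ℝ ℍ[ℝ] (φ t) (L q) := by
      filter_upwards [hbase] with q hq
      simp only [hL, ContinuousLinearMap.apply_apply, ContinuousLinearMap.comp_apply]
      rw [Trivialization.symmL_apply _ hq]
      rfl
    rw [mvfderiv_congr h1, mvfderiv_clm_comp _ hLd]
    rfl
  have hsymm : mc (γ t) (e.symm (γ t) (deriv φ t)) = L (γ t) (deriv φ t) := by
    simp only [hL, ContinuousLinearMap.comp_apply]
    rw [Trivialization.symmL_apply _ hmem]
  rw [covDerivAlong, map_add, hg.mc_leviCivita (FiberBundle.mdifferentiableAt_extend _ _ _), hext,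
    hder, FiberBundle.extend_apply_self]
  rw [← hsymm]
  abel

end S3

/-! ### Sectional curvatures and the Hopf fibres -/

namespace S3

variable {g : SmoothMetric (𝓡 3) S3} {r B : ℝ}

/-- In the left invariant framing, linearly independent vectors have a nonzero cross product. -/
theorem cross_pos {p : S3} {v w : TangentSpace (𝓡 3) p} (h : LinearIndependent ℝ ![v, w]) :
    0 < ((mc p v).imJ * (mc p w).imK - (mc p v).imK * (mc p w).imJ) ^ 2
      + (((mc p v).imK * (mc p w).imI - (mc p v).imI * (mc p w).imK) ^ 2
        + ((mc p v).imI * (mc p w).imJ - (mc p v).imJ * (mc p w).imI) ^ 2) := by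
  by_contra hcon
  rw [LinearIndependent.pair_iff] at h
  set x := mc p v with hx
  set y := mc p w with hy
  have h1 : x.imJ * y.imK - x.imK * y.imJ = 0 := by nlinarith
  have h2 : x.imK * y.imI - x.imI * y.imK = 0 := by nlinarith
  have h3 : x.imI * y.imJ - x.imJ * y.imI = 0 := by nlinarith
  -- the double cross product formula gives a linear relation
  have e : (y.imI ^ 2 + y.imJ ^ 2 + y.imK ^ 2) • v
      + (-(x.imI * y.imI + x.imJ * y.imJ + x.imK * y.imK)) • w = 0 := by
    apply mc_injective p
    rw [map_add, map_smul, map_smul, map_zero, ← hx, ← hy]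
    ext
    · simp [hx, hy, re_mc]
    · simp; linear_combination y.imJ * h3 - y.imK * h2
    · simp; linear_combination y.imK * h1 - y.imI * h3
    · simp; linear_combination y.imI * h2 - y.imJ * h1
  have h4 := (h _ _ e).1
  have hyI : y.imI = 0 := by nlinarith [sq_nonneg y.imI, sq_nonneg y.imJ, sq_nonneg y.imK]
  have hyJ : y.imJ = 0 := by nlinarith [sq_nonneg y.imI, sq_nonneg y.imJ, sq_nonneg y.imK]
  have hyK : y.imK = 0 := by nlinarith [sq_nonneg y.imI, sq_nonneg y.imJ, sq_nonneg y.imK]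
  have hw : w = 0 := by
    apply mc_injective p
    rw [map_zero, ← hy]
    ext
    · simp [hy, re_mc]
    · simpa using hyI
    · simpa using hyJ
    · simpa using hyK
  have h5 := (h 0 1 (by simp [hw])).2
  exact one_ne_zero h5

/-- The sectional curvatures of a Berger metric are weighted means of `r / B` (planes that contain
the Hopf direction) and `(4 - 3 r) / B` (the plane orthogonal to it). -/
theorem IsBerger.exists_sectionalCurvature_eq (hg : IsBerger g r B) (hB : 0 < B) (p : S3)
    {v w : TangentSpace (𝓡 3) p} (h : LinearIndependent ℝ ![v, w]) :
    ∃ X Y : ℝ, 0 ≤ X ∧ 0 ≤ Y ∧ 0 < X + Y ∧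
      sectionalCurvature g p v w = ((4 - 3 * r) * X + r ^ 2 * Y) / (B * (X + r * Y)) := by
  refine ⟨_, _, sq_nonneg _, ?_, cross_pos h, ?_⟩
  · positivity
  · rw [hg.sectionalCurvature_eq, sq B, mul_assoc B B, mul_div_mul_left _ _ hB.ne']

/-- A plane whose normal has no component in the direction `i` contains `i`. -/
theorem IsBerger.sectionalCurvature_of_cross (hg : IsBerger g r B) (hr : 0 < r) (hB : 0 < B)
    (p : S3) {v w : TangentSpace (𝓡 3) p}
    (h1 : (mc p v).imJ * (mc p w).imK - (mc p v).imK * (mc p w).imJ = 0)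
    (h2 : ((mc p v).imK * (mc p w).imI - (mc p v).imI * (mc p w).imK) ^ 2
        + ((mc p v).imI * (mc p w).imJ - (mc p v).imJ * (mc p w).imI) ^ 2 ≠ 0) :
    sectionalCurvature g p v w = r / B := by
  rw [hg.sectionalCurvature_eq, h1]
  generalize ((mc p v).imK * (mc p w).imI - (mc p v).imI * (mc p w).imK) ^ 2
        + ((mc p v).imI * (mc p w).imJ - (mc p v).imJ * (mc p w).imI) ^ 2 = Y at *
  field_simp
  ring

theorem mc_eq_of_incl {p : S3} {v : TangentSpace (𝓡 3) p} {u : ℍ[ℝ]}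
    (h : incl p v = (p : ℍ[ℝ]) * u) : mc p v = u :=
  (mc_eq_iff p v u).2 h

theorem IsBerger.sectionalCurvature_hopf (hg : IsBerger g r B) (hr : 0 < r) (hB : 0 < B)
    (p : S3) {x₁ v : TangentSpace (𝓡 3) p} (hx : mc p x₁ = qi)
    (h : LinearIndependent ℝ ![x₁, v]) : sectionalCurvature g p x₁ v = r / B := by
  have hc := cross_pos h
  have h1 : (mc p x₁).imJ * (mc p v).imK - (mc p x₁).imK * (mc p v).imJ = 0 := by
    simp [hx, qi_eq]
  refine hg.sectionalCurvature_of_cross hr hB p h1 ?_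
  rw [h1] at hc
  intro h0
  rw [h0] at hc
  simp at hc

theorem IsBerger.sectionalCurvature_horizontal (hg : IsBerger g r B) (hB : 0 < B)
    (p : S3) {x₂ x₃ : TangentSpace (𝓡 3) p} (hx₂ : mc p x₂ = qj) (hx₃ : mc p x₃ = qk) :
    sectionalCurvature g p x₂ x₃ = (4 - 3 * r) / B := by
  rw [hg.sectionalCurvature_eq, hx₂, hx₃]
  simp [qj_eq, qk_eq]
  field_simp

theorem IsBerger.setOf_sectionalCurvature (hg : IsBerger g r 1) (hr : 0 < r) :
    {κ : ℝ | ∃ (p : S3) (v w : TangentSpace (𝓡 3) p), LinearIndependent ℝ ![v, w] ∧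
      sectionalCurvature g p v w = κ} = Set.uIcc r (4 - 3 * r) := by
  ext κ
  constructor
  · rintro ⟨p, v, w, h, rfl⟩
    obtain ⟨X, Y, hX, hY, hXY, e⟩ := hg.exists_sectionalCurvature_eq one_pos p h
    have hpos : 0 < X + r * Y := by
      rcases hX.eq_or_lt with rfl | hX
      · have : 0 < Y := by linarith
        positivity
      · positivity
    rw [e, one_mul, Set.mem_uIcc, le_div_iff₀ hpos, div_le_iff₀ hpos, le_div_iff₀ hpos,
      div_le_iff₀ hpos]
    have hrY := mul_nonneg hr.le hY
    rcases le_total r 1 with h1 | h1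
    · left
      constructor <;> nlinarith [mul_nonneg (sub_nonneg.2 h1) hX, mul_nonneg (sub_nonneg.2 h1) hrY]
    · right
      constructor <;> nlinarith [mul_nonneg (sub_nonneg.2 h1) hX, mul_nonneg (sub_nonneg.2 h1) hrY]
  · intro hκ
    rw [← segment_eq_uIcc] at hκ
    obtain ⟨a, b, ha, hb, hab, rfl⟩ := hκ
    -- the plane spanned by `j` and `σ i + c k` realizes the convex combination
    set σ := √(a / r) with hσ
    set c := √b with hc
    have hσ2 : σ ^ 2 = a / r := Real.sq_sqrt (by positivity)
    have hc2 : c ^ 2 = b := Real.sq_sqrt hb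
    refine ⟨1, frame 1 (mkIm 0 1 0), frame 1 (mkIm σ 0 c), ?_, ?_⟩
    · rw [LinearIndependent.pair_iff]
      intro s t h
      have h' := congrArg (mc 1) h
      rw [map_add, map_smul, map_smul, map_zero, mc_frame _ (re_mkIm _ _ _),
        mc_frame _ (re_mkIm _ _ _)] at h'
      have hI := congrArg (fun q : ℍ[ℝ] ↦ q.imI) h'
      have hJ := congrArg (fun q : ℍ[ℝ] ↦ q.imJ) h'
      have hK := congrArg (fun q : ℍ[ℝ] ↦ q.imK) h'
      simp only [Quaternion.imI_add, Quaternion.imJ_add, Quaternion.imK_add,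
        Quaternion.imI_smul, Quaternion.imJ_smul, Quaternion.imK_smul, imI_mkIm, imJ_mkIm,
        imK_mkIm, smul_eq_mul, Quaternion.imI_zero, Quaternion.imJ_zero,
        Quaternion.imK_zero, mul_zero, mul_one, add_zero, zero_add] at hI hJ hK
      refine ⟨hJ, ?_⟩
      by_contra ht
      have h1 : σ = 0 := (mul_eq_zero.1 hI).resolve_left ht
      have h2 : c = 0 := (mul_eq_zero.1 hK).resolve_left ht
      rw [h1] at hσ2
      rw [h2] at hc2
      have h3 : a = 0 := by
        field_simp at hσ2
        linarith
      linarith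
    · rw [hg.sectionalCurvature_eq, mc_frame _ (re_mkIm _ _ _), mc_frame _ (re_mkIm _ _ _)]
      simp only [imI_mkIm, imJ_mkIm, imK_mkIm]
      have e : σ ^ 2 * r = a := by rw [hσ2]; field_simp
      have hden : (1 : ℝ) ^ 2 * ((1 * c - 0 * 0) ^ 2
          + r * ((0 * σ - 0 * c) ^ 2 + (0 * 0 - 1 * σ) ^ 2)) = 1 := by
        linear_combination hc2 + e + hab
      rw [hden, div_one, smul_eq_mul, smul_eq_mul]
      linear_combination (4 - 3 * r) * hc2 + r * e

theorem incl_velocity {γ : ℝ → S3} {t : ℝ} (hγ : MDifferentiableAt 𝓘(ℝ, ℝ) (𝓡 3) γ t) :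
    incl (γ t) (velocity (𝓡 3) γ t) = deriv (fun τ ↦ (γ τ : ℍ[ℝ])) t := by
  have h2 := mfderiv_comp_apply t ((contMDiff_coe (γ t)).mdifferentiableAt (by simp)) hγ (1 : ℝ)
  rw [mfderiv_eq_fderiv] at h2
  exact h2.symm

theorem expIQuaternion_eq (t : ℝ) : expIQuaternion t = Real.cos t • 1 + Real.sin t • qi := by
  ext <;> simp [qi_eq] <;> simp [expIQuaternion]

theorem mc_velocity_hopfFibre (p : S3) (t : ℝ) :
    mc (hopfFibre p t) (velocity (𝓡 3) (hopfFibre p) t) = qi := by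
  have hd : ContDiff ℝ ∞ (fun t ↦ (p : ℍ[ℝ]) * expIQuaternion t) := by
    simp only [expIQuaternion_eq]
    exact contDiff_const.mul ((Real.contDiff_cos.smul contDiff_const).add
      (Real.contDiff_sin.smul contDiff_const))
  have hs : ContMDiff 𝓘(ℝ, ℝ) (𝓡 3) ∞ (hopfFibre p) :=
    hd.contMDiff.codRestrict_sphere (fun t ↦ (hopfFibre p t).2)
  rw [mc_eq_iff, incl_velocity ((hs t).mdifferentiableAt (by simp))]
  have h1 : HasDerivAt (fun τ ↦ (p : ℍ[ℝ]) * expIQuaternion τ)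
      ((p : ℍ[ℝ]) * ((-Real.sin t) • 1 + Real.cos t • qi)) t := by
    simp only [expIQuaternion_eq]
    exact (((Real.hasDerivAt_cos t).smul_const (1 : ℍ[ℝ])).add
      ((Real.hasDerivAt_sin t).smul_const qi)).const_mul _
  refine h1.deriv.trans ?_
  change _ = (p : ℍ[ℝ]) * expIQuaternion t * qi
  rw [mul_assoc, expIQuaternion_eq]
  congr 1
  ext <;> simp [qi_eq]

end S3

/-! ### Geodesics and Jacobi fields -/

namespace S3

variable {g : SmoothMetric (𝓡 3) S3} {r B : ℝ} {γ : ℝ → S3} {s : Set ℝ}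

/-- The velocity of a smooth curve in the left invariant framing is smooth. -/
theorem contDiffOn_mc_velocity (hs : IsOpen s) (hγ : ContMDiffOn 𝓘(ℝ, ℝ) (𝓡 3) ∞ γ s) :
    ContDiffOn ℝ ∞ (fun t ↦ mc (γ t) (velocity (𝓡 3) γ t)) s := by
  have h1 : ContDiffOn ℝ ∞ (fun τ ↦ (γ τ : ℍ[ℝ])) s :=
    contMDiffOn_iff_contDiffOn.1 (contMDiff_coe.comp_contMDiffOn hγ)
  have h2 : ContDiffOn ℝ ∞ (deriv fun τ ↦ (γ τ : ℍ[ℝ])) s := h1.deriv_of_isOpen hs (by simp)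
  have h3 : ContDiffOn ℝ ∞ (fun τ ↦ star (γ τ : ℍ[ℝ])) s := starCLM.contDiff.comp_contDiffOn h1
  refine (h3.mul h2).congr fun t ht ↦ ?_
  rw [mc_apply, incl_velocity ((hγ.contMDiffAt (hs.mem_nhds ht)).mdifferentiableAt (by simp))]

/-- The geodesic equation is Euler's equation in the Lie algebra. -/
theorem IsBerger.hasDerivAt_mc_velocity (hg : IsBerger g r B) (hs : IsOpen s)
    (hγ : IsUnitSpeedGeodesicOn g γ s) {t : ℝ} (ht : t ∈ s) :
    HasDerivAt (fun t ↦ mc (γ t) (velocity (𝓡 3) γ t))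
      (-christoffel r (mc (γ t) (velocity (𝓡 3) γ t)) (mc (γ t) (velocity (𝓡 3) γ t))) t := by
  have hγd := (hγ.smooth.contMDiffAt (hs.mem_nhds ht)).mdifferentiableAt (by simp)
  have hx := ((contDiffOn_mc_velocity hs hγ.smooth).contDiffAt (hs.mem_nhds ht)).differentiableAt
    (by simp)
  have h := hg.mc_covDerivAlong hγd hx
  rw [hγ.geodesic t ht, map_zero] at h
  rw [← eq_neg_of_add_eq_zero_left h.symm]
  exact hx.hasDerivAt

/-- The angle between a geodesic and the Hopf fibres is constant. -/
theorem IsBerger.exists_imI_mc_velocity (hg : IsBerger g r B) (hs : IsOpen s)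
    (hs' : s.OrdConnected) (hγ : IsUnitSpeedGeodesicOn g γ s) :
    ∃ a : ℝ, ∀ t ∈ s, (mc (γ t) (velocity (𝓡 3) γ t)).imI = a := by
  have hd : ∀ t ∈ s, HasDerivAt (fun t ↦ (mc (γ t) (velocity (𝓡 3) γ t)).imI) 0 t := by
    intro t ht
    have h := (innerSL ℝ qi).hasFDerivAt.comp_hasDerivAt t (hg.hasDerivAt_mc_velocity hs hγ ht)
    have e : ∀ u : ℍ[ℝ], innerSL ℝ qi u = u.imI := fun u ↦ by
      simp [Quaternion.inner_def, qi_eq]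
    convert! h using 1
    · funext t
      exact (e _).symm
    · rw [e, Quaternion.imI_neg, christoffel_apply, imI_mkIm]
      ring
  exact hs.exists_is_const_of_deriv_eq_zero hs'.isPreconnected
    (fun t ht ↦ (hd t ht).differentiableAt.differentiableWithinAt) (fun t ht ↦ (hd t ht).deriv)

/-- The Jacobi equation in the left invariant framing. The curve `D₁` is the first covariant
derivative of the field given by the curve `j` in the Lie algebra. -/
theorem IsBerger.isJacobiFieldOn_frame (hg : IsBerger g r B) (hs : IsOpen s)
    (hγ : ContMDiffOn 𝓘(ℝ, ℝ) (𝓡 3) ∞ γ s) {j j' D₁ D₂ : ℝ → ℍ[ℝ]} (hj : ContDiffOn ℝ ∞ j s)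
    (hre : ∀ t, (j t).re = 0) (hj' : ∀ t ∈ s, HasDerivAt j (j' t) t)
    (hD₁ : ∀ t ∈ s, j' t + christoffel r (mc (γ t) (velocity (𝓡 3) γ t)) (j t) = D₁ t)
    (hD₂ : ∀ t ∈ s, HasDerivAt D₁ (D₂ t) t)
    (hjac : ∀ t ∈ s, D₂ t + christoffel r (mc (γ t) (velocity (𝓡 3) γ t)) (D₁ t)
      + leftCurvature r (j t) (mc (γ t) (velocity (𝓡 3) γ t))
        (mc (γ t) (velocity (𝓡 3) γ t)) = 0) :
    IsJacobiFieldOn g γ (fun t ↦ frame (γ t) (j t)) s where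
  smooth := contMDiff_frame.comp_contMDiffOn (hγ.prodMk hj.contMDiffOn)
  jacobi := by
    intro t ht
    have hγd : ∀ τ ∈ s, MDifferentiableAt 𝓘(ℝ, ℝ) (𝓡 3) γ τ := fun τ hτ ↦
      (hγ.contMDiffAt (hs.mem_nhds hτ)).mdifferentiableAt (by simp)
    have hmcj : (fun τ ↦ mc (γ τ) (frame (γ τ) (j τ))) = j :=
      funext fun τ ↦ mc_frame _ (hre τ)
    have h1 : ∀ τ ∈ s, mc (γ τ) (covDerivAlong g γ (fun t ↦ frame (γ t) (j t)) τ) = D₁ τ := by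
      intro τ hτ
      rw [hg.mc_covDerivAlong (hγd τ hτ) (by rw [hmcj]; exact (hj' τ hτ).differentiableAt), hmcj,
        (hj' τ hτ).deriv, mc_frame _ (hre τ), hD₁ τ hτ]
    have h2 : (fun τ ↦ mc (γ τ) (covDerivAlong g γ (fun t ↦ frame (γ t) (j t)) τ))
        =ᶠ[nhds t] D₁ := by
      filter_upwards [hs.mem_nhds ht] with τ hτ
      exact h1 τ hτ
    have h3 := (hD₂ t ht).congr_of_eventuallyEq h2
    apply mc_injective (γ t)
    rw [map_add, hg.mc_covDerivAlong (hγd t ht) h3.differentiableAt, h3.deriv, h1 t ht,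
      hg.mc_curvatureTensor, mc_frame _ (hre t), hjac t ht, map_zero]

/-- The vector field `p ↦ p i` is Killing, as its flow is the right multiplication by `exp (t i)`.
Its part normal to the geodesic is therefore a Jacobi field, which has no zeros because the geodesic
is not a Hopf fibre. -/
theorem IsBerger.exists_jacobi_of_ne (hg : IsBerger g r r) (hr : 0 < r) (hs : IsOpen s)
    (hγ : IsUnitSpeedGeodesicOn g γ s) {a : ℝ}
    (ha : ∀ t ∈ s, (mc (γ t) (velocity (𝓡 3) γ t)).imI = a) (hne : r * r * a ^ 2 ≠ 1) :
    ∃ J : Π t : ℝ, TangentSpace (𝓡 3) (γ t), IsJacobiFieldOn g γ J s ∧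
      ∀ t ∈ s, J t ≠ 0 ∧ g.inner (γ t) (J t) (velocity (𝓡 3) γ t) = 0 ∧
        sectionalCurvature g (γ t) (velocity (𝓡 3) γ t) (J t) = 1 := by
  set x : ℝ → ℍ[ℝ] := fun t ↦ mc (γ t) (velocity (𝓡 3) γ t) with hx
  have hxd : ∀ t ∈ s, HasDerivAt x (-christoffel r (x t) (x t)) t := fun t ht ↦
    hg.hasDerivAt_mc_velocity hs hγ ht
  have hxre : ∀ t, (x t).re = 0 := fun t ↦ re_mc _ _
  -- `r * r * a` is the inner product of `i` with the unit vector `x t`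
  set j : ℝ → ℍ[ℝ] := fun t ↦ qi - (r * r * a) • x t with hj
  have hre : ∀ t, (j t).re = 0 := fun t ↦ by simp [hj, hxre, qi_eq]
  have hunit : ∀ t ∈ s, r * (r * (a * a) + (x t).imJ * (x t).imJ + (x t).imK * (x t).imK) = 1 := by
    intro t ht
    have := hγ.unit_speed t ht
    rw [hg, leftForm_apply, ha t ht] at this
    exact this
  have hQ : ∀ t ∈ s, (x t).imJ ^ 2 + (x t).imK ^ 2 ≠ 0 := by
    intro t ht h0
    exact hne (by linear_combination hunit t ht - r * h0)
  have hmcj : ∀ t, mc (γ t) (frame (γ t) (j t)) = j t := fun t ↦ mc_frame _ (hre t)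
  refine ⟨fun t ↦ frame (γ t) (j t), ?_, fun t ht ↦ ⟨?_, ?_, ?_⟩⟩
  · refine hg.isJacobiFieldOn_frame (j' := fun t ↦ (r * r * a) • christoffel r (x t) (x t))
      (D₁ := fun t ↦ christoffel r (x t) qi)
      (D₂ := fun t ↦ christoffel r (-christoffel r (x t) (x t)) qi) hs hγ.smooth ?_ hre ?_ ?_ ?_ ?_
    · exact contDiffOn_const.sub ((contDiffOn_mc_velocity hs hγ.smooth).const_smul _)
    · intro t ht
      have := ((hxd t ht).const_smul (r * r * a)).const_sub qi
      simpa using this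
    · intro t ht
      simp only [hj]
      rw [map_sub, map_smul]
      abel
    · intro t ht
      exact ((christoffel r).flip qi).hasFDerivAt.comp_hasDerivAt t (hxd t ht)
    · intro t ht
      change _ + christoffel r (x t) _ + leftCurvature r (j t) (x t) (x t) = 0
      simp only [hj, leftCurvature, christoffel_apply]
      ext <;> simp [qi_eq, hxre] <;> ring
  · intro h0
    replace h0 : frame (γ t) (j t) = 0 := h0
    have h1 : j t = 0 := by rw [← hmcj t, h0, map_zero]
    have hI := congrArg (fun q : ℍ[ℝ] ↦ q.imI) h1
    have hI' : 1 - r * r * a * a = 0 := by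
      simpa [hj, qi_eq, hx, ha t ht] using hI
    exact hne (by linear_combination -hI')
  · rw [hg, hmcj, leftForm_apply]
    change r * (r * ((j t).imI * (x t).imI) + (j t).imJ * (x t).imJ + (j t).imK * (x t).imK) = 0
    have hxa : (x t).imI = a := ha t ht
    have e1 : (j t).imI = 1 - r * r * a * a := by simp [hj, qi_eq, hxa]
    have e2 : (j t).imJ = -(r * r * a * (x t).imJ) := by simp [hj, qi_eq]
    have e3 : (j t).imK = -(r * r * a * (x t).imK) := by simp [hj, qi_eq]
    rw [e1, e2, e3, hxa]
    linear_combination (- r * r * a) * hunit t ht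
  · have hxa : (x t).imI = a := ha t ht
    rw [hg.sectionalCurvature_of_cross hr hr, div_self hr.ne']
    · rw [hmcj]
      change (x t).imJ * (j t).imK - (x t).imK * (j t).imJ = 0
      simp [hj, qi_eq]
      ring
    · rw [hmcj]
      change ((x t).imK * (j t).imI - (x t).imI * (j t).imK) ^ 2
        + ((x t).imI * (j t).imJ - (x t).imJ * (j t).imI) ^ 2 ≠ 0
      have e : ((x t).imK * (j t).imI - (x t).imI * (j t).imK) ^ 2
        + ((x t).imI * (j t).imJ - (x t).imJ * (j t).imI) ^ 2
        = (x t).imJ ^ 2 + (x t).imK ^ 2 := by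
        simp [hj, qi_eq]; ring
      rw [e]
      exact hQ t ht

/-- Along a Hopf fibre a normal Jacobi field rotates with constant speed in the left invariant
framing. -/
theorem IsBerger.exists_jacobi_of_eq (hg : IsBerger g r r) (hr : 0 < r) (hs : IsOpen s)
    (hγ : IsUnitSpeedGeodesicOn g γ s) {a : ℝ}
    (ha : ∀ t ∈ s, (mc (γ t) (velocity (𝓡 3) γ t)).imI = a) (heq : r * r * a ^ 2 = 1) :
    ∃ J : Π t : ℝ, TangentSpace (𝓡 3) (γ t), IsJacobiFieldOn g γ J s ∧
      ∀ t ∈ s, J t ≠ 0 ∧ g.inner (γ t) (J t) (velocity (𝓡 3) γ t) = 0 ∧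
        sectionalCurvature g (γ t) (velocity (𝓡 3) γ t) (J t) = 1 := by
  have hxt : ∀ t ∈ s, mc (γ t) (velocity (𝓡 3) γ t) = mkIm a 0 0 := by
    intro t ht
    have h1 := hγ.unit_speed t ht
    have h2 := ha t ht
    have h3 := re_mc (γ t) (velocity (𝓡 3) γ t)
    rw [hg, leftForm_apply] at h1
    generalize mc (γ t) (velocity (𝓡 3) γ t) = x at *
    have h4 : r * (x.imJ ^ 2 + x.imK ^ 2) = 0 := by
      rw [h2] at h1
      linear_combination h1 - heq
    have h5 := (mul_eq_zero.1 h4).resolve_left hr.ne'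
    ext
    · exact h3
    · exact h2
    · change x.imJ = 0
      nlinarith [sq_nonneg x.imJ, sq_nonneg x.imK]
    · change x.imK = 0
      nlinarith [sq_nonneg x.imJ, sq_nonneg x.imK]
  have ha0 : a ≠ 0 := by rintro rfl; simp at heq
  -- parallel normal fields rotate with speed `-(2 - r) a` in the framing, and `j` has to rotate
  -- with speed one relative to them because all planes containing the velocity have curvature one
  set ν : ℝ := 1 - (2 - r) * a with hν
  set j : ℝ → ℍ[ℝ] := fun t ↦ Real.cos (ν * t) • qj + Real.sin (ν * t) • qk with hj
  set k : ℝ → ℍ[ℝ] := fun t ↦ (-Real.sin (ν * t)) • qj + Real.cos (ν * t) • qk with hk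
  have hre : ∀ t, (j t).re = 0 := fun t ↦ by simp [hj, qj_eq, qk_eq]
  have hmcj : ∀ t, mc (γ t) (frame (γ t) (j t)) = j t := fun t ↦ mc_frame _ (hre t)
  have hlin : ∀ t, HasDerivAt (fun t : ℝ ↦ ν * t) ν t := fun t ↦ by
    simpa using (hasDerivAt_id t).const_mul ν
  have hjd : ∀ t, HasDerivAt j (ν • k t) t := by
    intro t
    have h := ((hlin t).cos.smul_const qj).add ((hlin t).sin.smul_const qk)
    convert! h using 1
    simp only [hk]
    module
  have hkd : ∀ t, HasDerivAt k (-(ν • j t)) t := by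
    intro t
    have h := ((hlin t).sin.neg.smul_const qj).add ((hlin t).cos.smul_const qk)
    convert! h using 1
    simp only [hj]
    module
  have hcs : ∀ t, Real.cos (ν * t) ^ 2 + Real.sin (ν * t) ^ 2 = 1 := fun t ↦
    Real.cos_sq_add_sin_sq _
  refine ⟨fun t ↦ frame (γ t) (j t), ?_, fun t ht ↦ ⟨?_, ?_, ?_⟩⟩
  · refine hg.isJacobiFieldOn_frame (j' := fun t ↦ ν • k t) (D₁ := k)
      (D₂ := fun t ↦ -(ν • j t)) hs hγ.smooth ?_ hre (fun t _ ↦ hjd t) ?_ (fun t _ ↦ hkd t) ?_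
    · have hl : ContDiff ℝ ∞ fun t : ℝ ↦ ν * t := contDiff_const.mul contDiff_id
      exact ((hl.cos.smul contDiff_const).add (hl.sin.smul contDiff_const)).contDiffOn
    · intro t ht
      rw [hxt t ht]
      simp only [hj, hk, christoffel_apply]
      ext <;> simp [qj_eq, qk_eq, hν] <;> ring
    · intro t ht
      rw [hxt t ht]
      simp only [hj, hk, leftCurvature, christoffel_apply]
      ext
      · simp [qj_eq, qk_eq]
      · simp [qj_eq, qk_eq]
      · simp [qj_eq, qk_eq]
        linear_combination (Real.cos (ν * t)) * heq - Real.cos (ν * t) * hν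
      · simp [qj_eq, qk_eq]
        linear_combination (Real.sin (ν * t)) * heq - Real.sin (ν * t) * hν
  · intro h0
    replace h0 : frame (γ t) (j t) = 0 := h0
    have h1 : j t = 0 := by rw [← hmcj t, h0, map_zero]
    have hJ : Real.cos (ν * t) = 0 := by
      simpa [hj, qj_eq, qk_eq] using congrArg (fun q : ℍ[ℝ] ↦ q.imJ) h1
    have hK : Real.sin (ν * t) = 0 := by
      simpa [hj, qj_eq, qk_eq] using congrArg (fun q : ℍ[ℝ] ↦ q.imK) h1
    have := hcs t
    rw [hJ, hK] at this
    simp at this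
  · rw [hg, hmcj, hxt t ht, leftForm_apply]
    simp [hj, qj_eq, qk_eq]
  · rw [hg.sectionalCurvature_of_cross hr hr, div_self hr.ne']
    · rw [hxt t ht]
      simp
    · rw [hxt t ht, hmcj]
      have e : ((mkIm a 0 0).imK * (j t).imI - (mkIm a 0 0).imI * (j t).imK) ^ 2
          + ((mkIm a 0 0).imI * (j t).imJ - (mkIm a 0 0).imJ * (j t).imI) ^ 2 = a ^ 2 := by
        simp [hj, qj_eq, qk_eq]
        linear_combination a ^ 2 * hcs t
      rw [e]
      positivity

theorem IsBerger.hasNormalJacobiFieldsOfCurvatureOne (hg : IsBerger g r r) (hr : 0 < r) :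
    HasNormalJacobiFieldsOfCurvatureOne g := by
  intro γ s hs hs' hγ
  obtain ⟨a, ha⟩ := hg.exists_imI_mc_velocity hs hs' hγ
  by_cases h : r * r * a ^ 2 = 1
  · exact hg.exists_jacobi_of_eq hr hs hγ ha h
  · exact hg.exists_jacobi_of_ne hr hs hγ ha h

end S3

/-! ### Local isometries and the failure of local symmetry -/

namespace S3

variable {g : SmoothMetric (𝓡 3) S3} {r B : ℝ} {φ : S3 → S3} {U : Set S3} {q : S3}

theorem christoffel_sub_right (r : ℝ) (x y z : ℍ[ℝ]) :
    christoffel r x (y - z) = christoffel r x y - christoffel r x z :=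
  map_sub _ _ _

/-- The derivative of `f` along the left invariant field `p ↦ p u`. -/
def leftDeriv (u : ℍ[ℝ]) (f : S3 → ℍ[ℝ]) (q : S3) : ℍ[ℝ] :=
  mvfderiv (𝓡 3) f q (frame q u)

/-- The differential of a map of the sphere to itself in the left invariant framing. -/
def leftDifferential (φ : S3 → S3) (q : S3) : ℍ[ℝ] →L[ℝ] ℍ[ℝ] :=
  mc (φ q) ∘L mfderiv (𝓡 3) (𝓡 3) φ q ∘L frame q

theorem contMDiff_frame_const (u : ℍ[ℝ]) : ContMDiff (𝓡 3) (𝓡 3).tangent ∞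
    (fun y : S3 ↦ (⟨y, frame y u⟩ : TangentBundle (𝓡 3) S3)) :=
  contMDiff_frame.comp (contMDiff_id.prodMk contMDiff_const)

theorem mlieBracket_frame {u v : ℍ[ℝ]} (hu : u.re = 0) (hv : v.re = 0) (q : S3) :
    VectorField.mlieBracket (𝓡 3) (fun y ↦ frame y u) (fun y ↦ frame y v) q
      = frame q (u * v - v * u) := by
  have hd : ∀ u : ℍ[ℝ], MDifferentiableAt (𝓡 3) (𝓡 3).tangent
      (fun y : S3 ↦ (⟨y, frame y u⟩ : TangentBundle (𝓡 3) S3)) q := fun u ↦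
    (contMDiff_frame_const u q).mdifferentiableAt (by simp)
  have hre : (u * v - v * u).re = 0 := by simp; ring
  apply mc_injective q
  rw [mc_mlieBracket (hd u) (hd v), mc_frame q hre]
  simp only [mc_frame _ hu, mc_frame _ hv, mvfderiv_const]
  simp

theorem leftDeriv_comm {u v : ℍ[ℝ]} (hu : u.re = 0) (hv : v.re = 0) {f : S3 → ℍ[ℝ]}
    (hf : ContMDiffAt (𝓡 3) 𝓘(ℝ, ℍ[ℝ]) ∞ f q) :
    leftDeriv u (leftDeriv v f) q - leftDeriv v (leftDeriv u f) q
      = leftDeriv (u * v - v * u) f q := by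
  have h := mvfderiv_mlieBracket (hf.of_le (m := 2) ENat.LEInfty.out)
    ((contMDiff_frame_const u q).mdifferentiableAt (by simp))
    ((contMDiff_frame_const v q).mdifferentiableAt (by simp))
  rw [mlieBracket_frame hu hv] at h
  exact h.symm

theorem leftDeriv_congr {f f' : S3 → ℍ[ℝ]} (h : f =ᶠ[nhds q] f') (u : ℍ[ℝ]) :
    leftDeriv u f q = leftDeriv u f' q :=
  mvfderiv_congr h _

theorem leftDeriv_bilinear (b : ℍ[ℝ] →L[ℝ] ℍ[ℝ] →L[ℝ] ℍ[ℝ]) {f f' : S3 → ℍ[ℝ]}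
    (hf : MDifferentiableAt (𝓡 3) 𝓘(ℝ, ℍ[ℝ]) f q)
    (hf' : MDifferentiableAt (𝓡 3) 𝓘(ℝ, ℍ[ℝ]) f' q) (u : ℍ[ℝ]) :
    leftDeriv u (fun q ↦ b (f q) (f' q)) q
      = b (leftDeriv u f q) (f' q) + b (f q) (leftDeriv u f' q) :=
  mvfderiv_bilinear b hf hf' _

theorem leftDifferential_sub (φ : S3 → S3) (q : S3) (u v : ℍ[ℝ]) :
    leftDifferential φ q (u - v) = leftDifferential φ q u - leftDifferential φ q v :=
  map_sub _ _ _

theorem re_leftDifferential (φ : S3 → S3) (q : S3) (u : ℍ[ℝ]) :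
    (leftDifferential φ q u).re = 0 :=
  re_mc _ _

theorem re_leftDeriv_leftDifferential (φ : S3 → S3) (q : S3) (u v : ℍ[ℝ]) :
    (leftDeriv u (fun q ↦ leftDifferential φ q v) q).re = 0 :=
  re_mvfderiv (Filter.Eventually.of_forall fun q ↦ re_leftDifferential φ q v) _

theorem leftDeriv_coe_comp (hφ : MDifferentiableAt (𝓡 3) (𝓡 3) φ q) (u : ℍ[ℝ]) :
    leftDeriv u (fun q ↦ (φ q : ℍ[ℝ])) q = (φ q : ℍ[ℝ]) * leftDifferential φ q u := by
  have h := mfderiv_comp_apply q ((contMDiff_coe (φ q)).mdifferentiableAt (by simp)) hφ (frame q u)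
  exact h.trans (coe_mul_mc (φ q) _).symm

theorem contMDiffAt_leftDifferential (hU : IsOpen U) (hφ : ContMDiffOn (𝓡 3) (𝓡 3) ∞ φ U)
    (hq : q ∈ U) (u : ℍ[ℝ]) :
    ContMDiffAt (𝓡 3) 𝓘(ℝ, ℍ[ℝ]) ∞ (fun q ↦ leftDifferential φ q u) q := by
  have hφq := hφ.contMDiffAt (hU.mem_nhds hq)
  have h1 : ContMDiffAt (𝓡 3) 𝓘(ℝ, ℍ[ℝ]) ∞ (leftDeriv u fun q ↦ (φ q : ℍ[ℝ])) q :=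
    ContMDiffAt.mvfderiv_apply ((contMDiff_coe (φ q)).comp q hφq) (contMDiff_frame_const u q)
      (by simp)
  have h2 : ContMDiffAt (𝓡 3) 𝓘(ℝ, ℍ[ℝ]) ∞ (fun q ↦ star (φ q : ℍ[ℝ])) q :=
    (contMDiff_star_coe (φ q)).comp q hφq
  have h3 : ContDiff ℝ ∞ (fun z : ℍ[ℝ] × ℍ[ℝ] ↦ z.1 * z.2) := contDiff_mul
  refine (h3.contMDiff.contMDiffAt.comp q (h2.prodMk_space h1)).congr_of_eventuallyEq ?_
  filter_upwards [hU.mem_nhds hq] with y hy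
  simp only [Function.comp]
  rw [leftDeriv_coe_comp ((hφ.contMDiffAt (hU.mem_nhds hy)).mdifferentiableAt (by simp)),
    ← mul_assoc, star_mul_self, one_mul]

set_option synthInstance.maxHeartbeats 200000 in
/-- The pullback under `φ` of the Maurer–Cartan equation. -/
theorem leftDeriv_leftDifferential_sub (hU : IsOpen U) (hφ : ContMDiffOn (𝓡 3) (𝓡 3) ∞ φ U)
    (hq : q ∈ U) {u v : ℍ[ℝ]} (hu : u.re = 0) (hv : v.re = 0) :
    leftDeriv u (fun q ↦ leftDifferential φ q v) q - leftDeriv v (fun q ↦ leftDifferential φ q u) q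
      + (leftDifferential φ q u * leftDifferential φ q v
        - leftDifferential φ q v * leftDifferential φ q u)
      = leftDifferential φ q (u * v - v * u) := by
  have hd : ∀ y ∈ U, MDifferentiableAt (𝓡 3) (𝓡 3) φ y := fun y hy ↦
    (hφ.contMDiffAt (hU.mem_nhds hy)).mdifferentiableAt (by simp)
  have hf : ContMDiffAt (𝓡 3) 𝓘(ℝ, ℍ[ℝ]) ∞ (fun q ↦ (φ q : ℍ[ℝ])) q :=
    (contMDiff_coe (φ q)).comp q (hφ.contMDiffAt (hU.mem_nhds hq))
  have h2 : ∀ a b : ℍ[ℝ], leftDeriv a (leftDeriv b fun q ↦ (φ q : ℍ[ℝ])) q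
      = (φ q : ℍ[ℝ]) * (leftDifferential φ q a * leftDifferential φ q b
        + leftDeriv a (fun q ↦ leftDifferential φ q b) q) := by
    intro a b
    have e : leftDeriv b (fun q ↦ (φ q : ℍ[ℝ])) =ᶠ[nhds q] fun y ↦
        ContinuousLinearMap.mul ℝ ℍ[ℝ] (φ y : ℍ[ℝ]) (leftDifferential φ y b) := by
      filter_upwards [hU.mem_nhds hq] with y hy
      exact leftDeriv_coe_comp (hd y hy) b
    rw [leftDeriv_congr e, leftDeriv_bilinear _ (hf.mdifferentiableAt (by simp))
      ((contMDiffAt_leftDifferential hU hφ hq b).mdifferentiableAt (by simp)),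
      leftDeriv_coe_comp (hd q hq)]
    change (φ q : ℍ[ℝ]) * leftDifferential φ q a * leftDifferential φ q b + (φ q : ℍ[ℝ]) * _ = _
    rw [mul_add, mul_assoc]
  have h := leftDeriv_comm hu hv hf
  rw [h2, h2, leftDeriv_coe_comp (hd q hq), ← mul_sub] at h
  have h' := congrArg (star (φ q : ℍ[ℝ]) * ·) h
  simp only [← mul_assoc, star_mul_self, one_mul] at h'
  rw [← h']
  abel

theorem eq_zero_of_leftForm_self (hr : 0 < r) (hB : 0 < B) {u : ℍ[ℝ]} (hu : u.re = 0)
    (h : leftForm r B u u = 0) : u = 0 := by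
  rw [leftForm_apply, mul_eq_zero, or_iff_right hB.ne'] at h
  have hI := mul_nonneg hr.le (mul_self_nonneg u.imI)
  have hJ := mul_self_nonneg u.imJ
  have hK := mul_self_nonneg u.imK
  have hI' : r * (u.imI * u.imI) = 0 := by linarith
  ext
  · exact hu
  · exact mul_self_eq_zero.1 ((mul_eq_zero.1 hI').resolve_left hr.ne')
  · exact mul_self_eq_zero.1 (by linarith)
  · exact mul_self_eq_zero.1 (by linarith)

/-- `φ` preserves `g` at the points of `U`. -/
def IsIsometricOn (g : SmoothMetric (𝓡 3) S3) (φ : S3 → S3) (U : Set S3) : Prop :=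
  ∀ x ∈ U, ∀ v w : TangentSpace (𝓡 3) x,
    g.inner (φ x) (mfderiv (𝓡 3) (𝓡 3) φ x v) (mfderiv (𝓡 3) (𝓡 3) φ x w) = g.inner x v w

theorem IsBerger.leftForm_leftDifferential (hg : IsBerger g r B) (hiso : IsIsometricOn g φ U)
    (hq : q ∈ U) {u v : ℍ[ℝ]} (hu : u.re = 0) (hv : v.re = 0) :
    leftForm r B (leftDifferential φ q u) (leftDifferential φ q v) = leftForm r B u v := by
  have h := hiso q hq (frame q u) (frame q v)
  rw [hg, hg, mc_frame q hu, mc_frame q hv] at h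
  exact h

theorem IsIsometricOn.exists_leftDifferential_eq (hiso : IsIsometricOn g φ U) (hq : q ∈ U)
    {w : ℍ[ℝ]} (hw : w.re = 0) : ∃ u, u.re = 0 ∧ leftDifferential φ q u = w := by
  have hinj : Function.Injective (mfderiv (𝓡 3) (𝓡 3) φ q) := by
    rw [injective_iff_map_eq_zero]
    intro v hv
    by_contra h0
    have h := hiso q hq v v
    rw [hv, map_zero] at h
    exact (g.pos q v h0).ne h
  have : FiniteDimensional ℝ (TangentSpace (𝓡 3) q) :=
    inferInstanceAs (FiniteDimensional ℝ (EuclideanSpace ℝ (Fin 3)))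
  have hsurj : Function.Surjective (mfderiv (𝓡 3) (𝓡 3) φ q) :=
    (LinearMap.injective_iff_surjective_of_finrank_eq_finrank
      (f := (mfderiv (𝓡 3) (𝓡 3) φ q).toLinearMap) rfl).1 hinj
  obtain ⟨v, hv⟩ := exists_mc_eq (φ q) hw
  obtain ⟨v', rfl⟩ := hsurj v
  refine ⟨mc q v', re_mc _ _, ?_⟩
  rw [← hv]
  exact congrArg (fun z ↦ mc (φ q) (mfderiv (𝓡 3) (𝓡 3) φ q z)) (frame_mc q v')

/-- A local isometry preserves the Levi-Civita connection. The defect is symmetric in its two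
arguments because both connections are torsion free and skew because both are metric, hence zero. -/
theorem IsBerger.leftDeriv_leftDifferential (hg : IsBerger g r B) (hr : 0 < r) (hB : 0 < B)
    (hU : IsOpen U) (hφ : ContMDiffOn (𝓡 3) (𝓡 3) ∞ φ U) (hiso : IsIsometricOn g φ U)
    (hq : q ∈ U) {u v : ℍ[ℝ]} (hu : u.re = 0) (hv : v.re = 0) :
    leftDeriv u (fun q ↦ leftDifferential φ q v) q
      = leftDifferential φ q (christoffel r u v)
        - christoffel r (leftDifferential φ q u) (leftDifferential φ q v) := by
  set T : ℍ[ℝ] → ℍ[ℝ] → ℍ[ℝ] := fun u v ↦ leftDeriv u (fun q ↦ leftDifferential φ q v) q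
    + christoffel r (leftDifferential φ q u) (leftDifferential φ q v)
    - leftDifferential φ q (christoffel r u v) with hT
  have hsymm : ∀ {a b : ℍ[ℝ]}, a.re = 0 → b.re = 0 → T a b = T b a := by
    intro a b ha hb
    have h1 := leftDeriv_leftDifferential_sub hU hφ hq ha hb
    rw [← christoffel_sub_swap r, ← christoffel_sub_swap r, map_sub] at h1
    rw [← sub_eq_zero] at h1 ⊢
    rw [← h1]
    simp only [hT]
    abel
  have hskew : ∀ {a b c : ℍ[ℝ]}, a.re = 0 → b.re = 0 → c.re = 0 →
      leftForm r B (T c a) (leftDifferential φ q b)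
        + leftForm r B (T c b) (leftDifferential φ q a) = 0 := by
    intro a b c ha hb hc
    have hd : ∀ w, MDifferentiableAt (𝓡 3) 𝓘(ℝ, ℍ[ℝ]) (fun q ↦ leftDifferential φ q w) q :=
      fun w ↦ (contMDiffAt_leftDifferential hU hφ hq w).mdifferentiableAt (by simp)
    have h1 := mvfderiv_bilinear (leftForm r B) (hd a) (hd b) (frame q c)
    have h2 : (fun q ↦ leftForm r B (leftDifferential φ q a) (leftDifferential φ q b))
        =ᶠ[nhds q] fun _ ↦ leftForm r B a b := by
      filter_upwards [hU.mem_nhds hq] with y hy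
      exact hg.leftForm_leftDifferential hiso hy ha hb
    rw [mvfderiv_congr h2, mvfderiv_const] at h1
    have h3 := leftForm_christoffel r B (leftDifferential φ q c) (leftDifferential φ q a)
      (leftDifferential φ q b)
    have h4 := leftForm_christoffel r B c a b
    rw [← hg.leftForm_leftDifferential hiso hq (by rw [christoffel_apply, re_mkIm]) hb,
      ← hg.leftForm_leftDifferential hiso hq ha (by rw [christoffel_apply, re_mkIm])] at h4
    rw [leftForm_comm r B (T c b)]
    simp only [hT, map_sub, map_add, sub_apply, add_apply]
    change (0 : ℝ) = leftForm r B (leftDeriv c (fun q ↦ leftDifferential φ q a) q) _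
      + leftForm r B _ (leftDeriv c (fun q ↦ leftDifferential φ q b) q) at h1
    linarith
  -- a trilinear form symmetric in the first and skew in the last two arguments vanishes
  have hzero : ∀ {a b c : ℍ[ℝ]}, a.re = 0 → b.re = 0 → c.re = 0 →
      leftForm r B (T a b) (leftDifferential φ q c) = 0 := by
    intro a b c ha hb hc
    have h1 := hskew hb hc ha
    have h2 := hskew hc ha hb
    have h3 := hskew ha hb hc
    rw [hsymm hb hc, hsymm hb ha] at h2
    rw [hsymm hc ha] at h3
    linarith
  have hre : (T u v).re = 0 := by
    simp [hT, re_leftDeriv_leftDifferential, re_leftDifferential, christoffel_apply]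
  obtain ⟨c, hc, hcT⟩ := hiso.exists_leftDifferential_eq hq hre
  have h0 : T u v = 0 := by
    apply eq_zero_of_leftForm_self hr hB hre
    have := hzero hu hv hc
    rwa [hcT] at this
  rw [← sub_eq_zero, ← h0]
  simp only [hT]
  abel

/-- A local isometry preserves the curvature tensor. -/
theorem IsBerger.leftDifferential_leftCurvature (hg : IsBerger g r B) (hr : 0 < r) (hB : 0 < B)
    (hU : IsOpen U) (hφ : ContMDiffOn (𝓡 3) (𝓡 3) ∞ φ U) (hiso : IsIsometricOn g φ U)
    (hq : q ∈ U) {u v w : ℍ[ℝ]} (hu : u.re = 0) (hv : v.re = 0) (hw : w.re = 0) :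
    leftDifferential φ q (leftCurvature r u v w)
      = leftCurvature r (leftDifferential φ q u) (leftDifferential φ q v)
          (leftDifferential φ q w) := by
  have hΓ : ∀ a b, (christoffel r a b).re = 0 := fun a b ↦ by rw [christoffel_apply, re_mkIm]
  have hd : ∀ w, MDifferentiableAt (𝓡 3) 𝓘(ℝ, ℍ[ℝ]) (fun q ↦ leftDifferential φ q w) q :=
    fun w ↦ (contMDiffAt_leftDifferential hU hφ hq w).mdifferentiableAt (by simp)
  have h2 : ∀ {a b : ℍ[ℝ]}, a.re = 0 → b.re = 0 →
      leftDeriv a (leftDeriv b fun q ↦ leftDifferential φ q w) q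
      = leftDeriv a (fun q ↦ leftDifferential φ q (christoffel r b w)) q
        - (christoffel r (leftDeriv a (fun q ↦ leftDifferential φ q b) q) (leftDifferential φ q w)
          + christoffel r (leftDifferential φ q b)
            (leftDeriv a (fun q ↦ leftDifferential φ q w) q)) := by
    intro a b ha hb
    have e : leftDeriv b (fun q ↦ leftDifferential φ q w) =ᶠ[nhds q] fun y ↦
        leftDifferential φ y (christoffel r b w)
          - christoffel r (leftDifferential φ y b) (leftDifferential φ y w) := by
      filter_upwards [hU.mem_nhds hq] with y hy
      exact hg.leftDeriv_leftDifferential hr hB hU hφ hiso hy hb hw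
    rw [leftDeriv_congr e, ← leftDeriv_bilinear _ (hd b) (hd w)]
    have := mvfderiv_fun_sub (hd (christoffel r b w))
      (MDifferentiableAt.bilinear (christoffel r) (hd b) (hd w))
    exact congrArg (· (frame q a)) this
  have key := fun {a b : ℍ[ℝ]} (ha : a.re = 0) (hb : b.re = 0) ↦
    hg.leftDeriv_leftDifferential hr hB hU hφ hiso hq ha hb
  have hre : (u * v - v * u).re = 0 := by simp; ring
  have h := leftDeriv_comm hu hv (contMDiffAt_leftDifferential hU hφ hq w)
  rw [h2 hu hv, h2 hv hu, key hre hw, key hu (hΓ v w), key hv (hΓ u w), key hu hv,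
    key hv hu, key hu hw, key hv hw] at h
  rw [← christoffel_sub_swap r] at h
  rw [leftCurvature, leftCurvature, ← christoffel_sub_swap r, ← christoffel_sub_swap r]
  simp only [leftDifferential_sub, christoffel_sub_left, christoffel_sub_right] at h ⊢
  rw [← sub_eq_zero] at h ⊢
  rw [← h]
  abel

/-- For `r ≠ 1` the plane spanned by `j` and `k` is singled out by its sectional curvature, so
that a local isometry preserves it. -/
theorem IsBerger.imI_leftDifferential_qk (hg : IsBerger g r B) (hr : 0 < r) (hr1 : r ≠ 1)
    (hB : 0 < B) (hU : IsOpen U) (hφ : ContMDiffOn (𝓡 3) (𝓡 3) ∞ φ U)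
    (hiso : IsIsometricOn g φ U) (hq : q ∈ U) : (leftDifferential φ q qk).imI = 0 := by
  have hj : qj.re = 0 := rfl
  have hk : qk.re = 0 := rfl
  have hR : (leftCurvature r qj qk qk).re = 0 := by
    simp only [leftCurvature, christoffel_apply, Quaternion.re_sub, re_mkIm, sub_zero]
  have h1 := hg.leftForm_leftDifferential hiso hq hR hj
  rw [hg.leftDifferential_leftCurvature hr hB hU hφ hiso hq hj hk hk, leftForm_leftCurvature,
    leftForm_leftCurvature] at h1
  have h2 := leftForm_gram r B (leftDifferential φ q qj) (leftDifferential φ q qk)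
  rw [hg.leftForm_leftDifferential hiso hq hj hj, hg.leftForm_leftDifferential hiso hq hk hk,
    hg.leftForm_leftDifferential hiso hq hj hk, leftForm_gram] at h2
  generalize leftDifferential φ q qj = x at *
  generalize leftDifferential φ q qk = y at *
  simp only [qj_eq, qk_eq, imI_mkIm, imJ_mkIm, imK_mkIm] at h1 h2
  set m := (x.imK * y.imI - x.imI * y.imK) ^ 2 + (x.imI * y.imJ - x.imJ * y.imI) ^ 2 with hm
  have h3 := mul_left_cancel₀ hB.ne' h1
  have h4 := mul_left_cancel₀ (pow_pos hB 2).ne' h2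
  have h5 : r * (r - 1) * m = 0 := by linear_combination (h3 + (4 - 3 * r) * h4) / 4
  have h6 : m = 0 := (mul_eq_zero.1 h5).resolve_left (mul_ne_zero hr.ne' (sub_ne_zero.2 hr1))
  have h7 : x.imK * y.imI - x.imI * y.imK = 0 := by
    nlinarith [sq_nonneg (x.imK * y.imI - x.imI * y.imK), sq_nonneg (x.imI * y.imJ - x.imJ * y.imI)]
  have h8 : x.imI * y.imJ - x.imJ * y.imI = 0 := by
    nlinarith [sq_nonneg (x.imK * y.imI - x.imI * y.imK), sq_nonneg (x.imI * y.imJ - x.imJ * y.imI)]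
  rw [h6] at h4
  linear_combination y.imI * h4 - (x.imJ * y.imK - x.imK * y.imJ) * (y.imJ * h7 + y.imK * h8)

/-- A local isometry `φ` with differential `-id` at the point `1` would preserve the planes spanned
by `j` and `k`, so that the component of `dφ k` in the direction `i` vanishes near `1`. But by
invariance of the connection its derivative along `j` at `1` is `-2`. -/
theorem IsBerger.not_isLocallySymmetricMetric (hg : IsBerger g r B) (hr : 0 < r) (hr1 : r ≠ 1)
    (hB : 0 < B) : ¬ IsLocallySymmetricMetric g := by
  intro hsymm
  obtain ⟨U, φ, hU, hp, hφ, hiso, ht⟩ := hsymm 1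
  have hF : ∀ {u : ℍ[ℝ]}, u.re = 0 → leftDifferential φ 1 u = -u := by
    intro u hu
    have h := congrArg (fun z : TangentBundle (𝓡 3) S3 ↦ mc z.1 z.2) (ht (frame 1 u))
    have h' : mc (φ 1) (mfderiv (𝓡 3) (𝓡 3) φ 1 (frame 1 u)) = mc 1 (-frame 1 u) := h
    rw [map_neg, mc_frame 1 hu] at h'
    exact h'
  have h := hg.leftDeriv_leftDifferential hr hB hU hφ hiso hp (u := qj) (v := qk) rfl rfl
  have h0 : (leftDeriv qj (fun q ↦ leftDifferential φ q qk) 1).imI = 0 := by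
    set L : ℍ[ℝ] →L[ℝ] ℝ := innerSL ℝ qi with hL
    have hI : ∀ u, L u = u.imI := fun u ↦ by simp [hL, Quaternion.inner_def, qi_eq]
    have h1 := mvfderiv_clm_comp L
      ((contMDiffAt_leftDifferential hU hφ hp qk).mdifferentiableAt (by simp)) (frame 1 qj)
    have h2 : (fun q ↦ L (leftDifferential φ q qk)) =ᶠ[nhds 1] fun _ ↦ 0 := by
      filter_upwards [hU.mem_nhds hp] with y hy
      rw [hI, hg.imI_leftDifferential_qk hr hr1 hB hU hφ hiso hy]
    rw [mvfderiv_congr h2, mvfderiv_const, hI] at h1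
    exact h1.symm
  have hΓ : (christoffel r qj qk).re = 0 := rfl
  rw [h, hF hΓ, hF (u := qj) rfl, hF (u := qk) rfl] at h0
  simp only [christoffel_apply, Quaternion.imI_sub, Quaternion.imI_neg, Quaternion.imJ_neg,
    Quaternion.imK_neg, qj_eq, qk_eq, imI_mkIm, imJ_mkIm, imK_mkIm] at h0
  norm_num at h0

end S3

theorem IsSymmetricMetric.isLocallySymmetricMetric {E : Type*} [NormedAddCommGroup E]
    [NormedSpace ℝ E] {H : Type*} [TopologicalSpace H] {I : ModelWithCorners ℝ E H} {M : Type*}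
    [TopologicalSpace M] [ChartedSpace H M] [IsManifold I ∞ M] {g : SmoothMetric I M}
    (h : IsSymmetricMetric g) : IsLocallySymmetricMetric g := by
  intro p
  obtain ⟨φ, hiso, ht⟩ := h p
  exact ⟨Set.univ, φ, isOpen_univ, trivial, φ.contMDiff.contMDiffOn, fun x _ ↦ hiso x, ht⟩

/-! ### Spheres of dimension at least two are simply connected -/

section Sphere

variable {E : Type*} [NormedAddCommGroup E] [InnerProductSpace ℝ E]

/-- The complement of a point is homeomorphic to a vector space by stereographic projection. -/
theorem isSimplyConnected_compl_singleton_sphere (v : Metric.sphere (0 : E) 1) :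
    IsSimplyConnected ({v}ᶜ : Set (Metric.sphere (0 : E) 1)) := by
  have hv : ‖(v : E)‖ = 1 := by simp
  have h := (isOpenEmbedding_stereographic_symm hv).isEmbedding.toHomeomorph
  rw [range_stereographic_symm hv v.2] at h
  exact h.symm.toHomotopyEquiv.simplyConnectedSpace

/-- Radial projection to the unit sphere turns a straight line homotopy in the complement of the
origin into a homotopy of loops. -/
theorem exists_homotopic_radial (x : Metric.sphere (0 : E) 1) (γ : Path x x) {q : ℝ → E}
    (hq : Continuous q) (h0 : q 0 = x) (h1 : q 1 = x)
    (hdist : ∀ t : unitInterval, ‖q t - γ t‖ < 1) :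
    ∃ γ' : Path x x, γ.Homotopic γ' ∧
      ∀ t : unitInterval, q t ≠ 0 ∧ (γ' t : E) = ‖q t‖⁻¹ • q t := by
  have hx : ‖(x : E)‖ = 1 := by simp
  set f : unitInterval × unitInterval → E := fun z ↦ (γ z.2 : E) + (z.1 : ℝ) • (q z.2 - γ z.2)
    with hf
  have hf0 : ∀ z, f z ≠ 0 := by
    intro z hz
    have e : (z.1 : ℝ) • (q z.2 - γ z.2) = -(γ z.2 : E) :=
      eq_neg_of_add_eq_zero_right hz
    have e' := congrArg norm e
    rw [norm_neg, norm_smul, norm_eq_of_mem_sphere, Real.norm_of_nonneg z.1.2.1] at e'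
    nlinarith [z.1.2.1, z.1.2.2, hdist z.2, norm_nonneg (q z.2 - γ z.2)]
  have hfc : Continuous f := by
    have h1 : Continuous fun z : unitInterval × unitInterval ↦ (γ z.2 : E) :=
      continuous_subtype_val.comp (γ.continuous.comp continuous_snd)
    have h2 : Continuous fun z : unitInterval × unitInterval ↦ q z.2 :=
      hq.comp (continuous_subtype_val.comp continuous_snd)
    exact h1.add ((continuous_subtype_val.comp continuous_fst).smul (h2.sub h1))
  set H : unitInterval × unitInterval → Metric.sphere (0 : E) 1 := fun z ↦
    ⟨‖f z‖⁻¹ • f z, by simp [norm_smul, hf0 z]⟩ with hH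
  have hHc : Continuous H :=
    ((hfc.norm.inv₀ fun z ↦ norm_ne_zero_iff.2 (hf0 z)).smul hfc).subtype_mk _
  have hH0 : ∀ s, H (s, 0) = x := by
    intro s
    ext1
    simp [hH, hf, h0]
  have hH1 : ∀ s, H (s, 1) = x := by
    intro s
    ext1
    simp [hH, hf, h1]
  have hH1c : Continuous fun t ↦ H (1, t) := by fun_prop
  set γ' : Path x x :=
    { toFun := fun t ↦ H (1, t)
      continuous_toFun := hH1c
      source' := hH0 1
      target' := hH1 1 }
  refine ⟨γ', ⟨?_⟩, fun t ↦ ?_⟩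
  · exact
      { toFun := H
        continuous_toFun := hHc
        map_zero_left := fun t ↦ by ext1; simp [hH, hf]
        map_one_left := fun _ ↦ rfl
        prop' := by
          rintro s t (rfl | rfl)
          · simpa using hH0 s
          · simpa using hH1 s }
  · have e : f (1, t) = q t := by simp [hf]
    refine ⟨e ▸ hf0 (1, t), ?_⟩
    change ‖f (1, t)‖⁻¹ • f (1, t) = _
    rw [e]

/-- Every loop in the sphere is homotopic to the radial projection of a smooth one; in dimension
at least three, the cone over the latter misses some direction. -/
theorem exists_homotopic_forall_ne [FiniteDimensional ℝ E] (hE : 2 < Module.finrank ℝ E)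
    (x : Metric.sphere (0 : E) 1) (γ : Path x x) :
    ∃ (γ' : Path x x) (v : Metric.sphere (0 : E) 1), γ.Homotopic γ' ∧ ∀ t, γ' t ≠ v := by
  have hγc : Continuous fun t : ℝ ↦ (γ.extend t : E) :=
    continuous_subtype_val.comp γ.continuous_extend
  obtain ⟨g, hg, hdist, -⟩ := hγc.exists_contDiff_approx 1 (ε := fun _ ↦ 1 / 4)
    continuous_const (fun _ ↦ by norm_num)
  -- a linear correction gives the smooth approximation the end points of `γ`
  set q : ℝ → E := fun t ↦ g t + ((1 - t) • ((x : E) - g 0) + t • ((x : E) - g 1)) with hq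
  have hqd : ContDiff ℝ 1 q :=
    hg.add (((contDiff_const.sub contDiff_id).smul contDiff_const).add
      (contDiff_id.smul contDiff_const))
  have hg0 := hdist 0
  have hg1 := hdist 1
  rw [γ.extend_zero, dist_comm, dist_eq_norm] at hg0
  rw [γ.extend_one, dist_comm, dist_eq_norm] at hg1
  have hqγ : ∀ t : unitInterval, ‖q t - γ t‖ < 1 := by
    intro t
    have ht := hdist t
    rw [γ.extend_apply t.2, dist_eq_norm] at ht
    have e : q t - γ t = (g t - γ t) + ((1 - (t : ℝ)) • ((x : E) - g 0)
      + (t : ℝ) • ((x : E) - g 1)) := by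
      simp only [hq]; abel
    rw [e]
    refine (norm_add_le _ _).trans_lt ?_
    have h1 := norm_add_le ((1 - (t : ℝ)) • ((x : E) - g 0)) ((t : ℝ) • ((x : E) - g 1))
    rw [norm_smul, norm_smul, Real.norm_of_nonneg t.2.1,
      Real.norm_of_nonneg (sub_nonneg.2 t.2.2)] at h1
    nlinarith [t.2.1, t.2.2]
  obtain ⟨γ', hγ', hγq⟩ := exists_homotopic_radial x γ hqd.continuous (by simp [hq])
    (by simp [hq]) hqγ
  have hcone : ContDiff ℝ 1 (fun z : ℝ × ℝ ↦ z.1 • q z.2) :=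
    contDiff_fst.smul (hqd.comp contDiff_snd)
  obtain ⟨w, hw⟩ := (hcone.dense_compl_range_of_finrank_lt_finrank (by simpa using hE)).nonempty
  have hw0 : w ≠ 0 := by
    rintro rfl
    exact hw ⟨(0, 0), by simp⟩
  refine ⟨γ', ⟨‖w‖⁻¹ • w, by simp [norm_smul, hw0]⟩, hγ', fun t ht ↦ hw ?_⟩
  have h := congrArg Subtype.val ht
  rw [(hγq t).2] at h
  refine ⟨(‖w‖ * ‖q t‖⁻¹, t), ?_⟩
  change (‖w‖ * ‖q t‖⁻¹) • q t = w
  rw [mul_smul, h, smul_smul, mul_inv_cancel₀ (norm_ne_zero_iff.2 hw0), one_smul]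

/-- The unit sphere of a space of dimension at least three is simply connected. -/
theorem simplyConnectedSpace_sphere [FiniteDimensional ℝ E] (hE : 2 < Module.finrank ℝ E) :
    SimplyConnectedSpace (Metric.sphere (0 : E) 1) := by
  rw [simply_connected_iff_loops_nullhomotopic]
  refine ⟨isPathConnected_iff_pathConnectedSpace.1 (isPathConnected_sphere ?_ 0 zero_le_one),
    fun x γ ↦ ?_⟩
  · rw [← Module.finrank_eq_rank]
    exact_mod_cast (by omega : 1 < Module.finrank ℝ E)
  · obtain ⟨γ', v, hγ, hv⟩ := exists_homotopic_forall_ne hE x γ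
    obtain ⟨F, -⟩ := (isSimplyConnected_iff_exists_homotopy_refl_forall_mem.1
      (isSimplyConnected_compl_singleton_sphere v)).2 x γ' hv
    exact hγ.trans ⟨F⟩

end Sphere

/-! ### Curvature bounds and length of the Hopf fibres -/

namespace S3

variable {g : SmoothMetric (𝓡 3) S3} {r B : ℝ}

theorem IsBerger.secGE_one (hg : IsBerger g r r) (hr : 0 < r) (hr1 : r ≤ 1) : SecGE g 1 := by
  intro p v w h
  obtain ⟨X, Y, hX, hY, hXY, e⟩ := hg.exists_sectionalCurvature_eq hr p h
  have hpos : 0 < X + r * Y := by nlinarith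
  rw [e, le_div_iff₀ (mul_pos hr hpos)]
  nlinarith

theorem IsBerger.secLE_one (hg : IsBerger g r r) (hr1 : 1 ≤ r) : SecLE g 1 := by
  intro p v w h
  obtain ⟨X, Y, hX, hY, hXY, e⟩ := hg.exists_sectionalCurvature_eq (by linarith) p h
  have hpos : 0 < X + r * Y := by nlinarith
  rw [e, div_le_iff₀ (mul_pos (by linarith) hpos)]
  nlinarith

theorem IsBerger.sectionalCurvature_pos (hg : IsBerger g r B) (hr : 0 < r) (hB : 0 < B)
    (hr' : 3 * r < 4) (p : S3) {v w : TangentSpace (𝓡 3) p} (h : LinearIndependent ℝ ![v, w]) :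
    0 < sectionalCurvature g p v w := by
  obtain ⟨X, Y, hX, hY, hXY, e⟩ := hg.exists_sectionalCurvature_eq hB p h
  rw [e]
  rcases hX.eq_or_lt with rfl | hX
  · have : 0 < Y := by simpa using hXY
    positivity
  · have : 0 < (4 - 3 * r) * X := mul_pos (by linarith) hX
    positivity

theorem length_hopfFibre (η : ℝ) (hη : 0 < η) (p : S3) :
    ∫ t in (0 : ℝ)..(2 * Real.pi), √((bergerMetric η hη).inner (hopfFibre p t)
      (velocity (𝓡 3) (hopfFibre p) t) (velocity (𝓡 3) (hopfFibre p) t)) = 2 * Real.pi * η := by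
  have h : ∀ t, √((bergerMetric η hη).inner (hopfFibre p t)
      (velocity (𝓡 3) (hopfFibre p) t) (velocity (𝓡 3) (hopfFibre p) t)) = η := by
    intro t
    rw [isBerger_bergerMetric η hη, mc_velocity_hopfFibre, leftForm_apply]
    simp [qi_eq, Real.sqrt_sq hη.le]
  simp only [h]
  simp

end S3

end

theorem mainTheorem9 :
    -- the sphere is a simply connected compact manifold
    CompactSpace S3 ∧ SimplyConnectedSpace S3 ∧
    -- curvature of the Berger metrics `g_η` and length of the Hopf fibres
    (∀ (η : ℝ) (hη : 0 < η),
      (∀ (p : S3) (x₁ v : TangentSpace (𝓡 3) p), S3.incl p x₁ = (p : ℍ[ℝ]) * S3.qi →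
        LinearIndependent ℝ ![x₁, v] →
        sectionalCurvature (S3.bergerMetric η hη) p x₁ v = η ^ 2) ∧
      (∀ (p : S3) (x₂ x₃ : TangentSpace (𝓡 3) p), S3.incl p x₂ = (p : ℍ[ℝ]) * S3.qj →
        S3.incl p x₃ = (p : ℍ[ℝ]) * S3.qk →
        sectionalCurvature (S3.bergerMetric η hη) p x₂ x₃ = 4 - 3 * η ^ 2) ∧
      {κ : ℝ | ∃ (p : S3) (v w : TangentSpace (𝓡 3) p), LinearIndependent ℝ ![v, w] ∧
        sectionalCurvature (S3.bergerMetric η hη) p v w = κ} = Set.uIcc (η ^ 2) (4 - 3 * η ^ 2) ∧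
      (∀ p : S3, ∫ t in (0 : ℝ)..(2 * Real.pi),
        √((S3.bergerMetric η hη).inner (S3.hopfFibre p t)
          (velocity (𝓡 3) (S3.hopfFibre p) t) (velocity (𝓡 3) (S3.hopfFibre p) t))
        = 2 * Real.pi * η)) ∧
    -- shrunk Hopf fibres, normalized: lower curvature bound one
    (∀ (η : ℝ) (hη : 0 < η), η < 1 →
      HasWeakLowerSphericalRank (S3.normalizedBergerMetric η hη) ∧
      ¬ IsSymmetricMetric (S3.normalizedBergerMetric η hη) ∧
      ¬ IsLocallySymmetricMetric (S3.normalizedBergerMetric η hη)) ∧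
    -- enlarged Hopf fibres, normalized: upper curvature bound one
    (∀ (η : ℝ) (hη : 0 < η), 1 < η →
      HasWeakUpperSphericalRank (S3.normalizedBergerMetric η hη) ∧
      ¬ IsSymmetricMetric (S3.normalizedBergerMetric η hη) ∧
      ¬ IsLocallySymmetricMetric (S3.normalizedBergerMetric η hη) ∧
      (η < 2 / √3 → ∀ (p : S3) (v w : TangentSpace (𝓡 3) p), LinearIndependent ℝ ![v, w] →
        0 < sectionalCurvature (S3.normalizedBergerMetric η hη) p v w)) := by
  have hne : ∀ η : ℝ, 0 < η → η ≠ 1 → η ^ 2 ≠ 1 := fun η hη h1 h ↦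
    h1 ((pow_eq_one_iff_of_nonneg hη.le two_ne_zero).1 h)
  have hls : ∀ (η : ℝ) (hη : 0 < η), η ≠ 1 →
      ¬ IsLocallySymmetricMetric (S3.normalizedBergerMetric η hη) := fun η hη h1 ↦
    (S3.isBerger_normalizedBergerMetric η hη).not_isLocallySymmetricMetric (pow_pos hη 2)
      (hne η hη h1) (pow_pos hη 2)
  refine ⟨inferInstance, simplyConnectedSpace_sphere (by simp [Quaternion.finrank_eq_four]),
    fun η hη ↦ ⟨fun p x₁ v hx h ↦ ?_, fun p x₂ x₃ h₂ h₃ ↦ ?_, ?_, S3.length_hopfFibre η hη⟩,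
    fun η hη h1 ↦ ⟨⟨inferInstance, ?_, ?_⟩, fun h ↦ ?_, hls η hη h1.ne⟩,
    fun η hη h1 ↦ ⟨⟨inferInstance, ?_, ?_⟩, fun h ↦ ?_, hls η hη h1.ne', fun h p v w hvw ↦ ?_⟩⟩
  · rw [(S3.isBerger_bergerMetric η hη).sectionalCurvature_hopf (pow_pos hη 2) one_pos p
      (S3.mc_eq_of_incl hx) h, div_one]
  · rw [(S3.isBerger_bergerMetric η hη).sectionalCurvature_horizontal one_pos p
      (S3.mc_eq_of_incl h₂) (S3.mc_eq_of_incl h₃), div_one]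
  · exact (S3.isBerger_bergerMetric η hη).setOf_sectionalCurvature (pow_pos hη 2)
  · exact (S3.isBerger_normalizedBergerMetric η hη).secGE_one (pow_pos hη 2)
      (pow_le_one₀ hη.le h1.le)
  · exact (S3.isBerger_normalizedBergerMetric η hη).hasNormalJacobiFieldsOfCurvatureOne
      (pow_pos hη 2)
  · exact hls η hη h1.ne h.isLocallySymmetricMetric
  · exact (S3.isBerger_normalizedBergerMetric η hη).secLE_one (one_le_pow₀ h1.le)
  · exact (S3.isBerger_normalizedBergerMetric η hη).hasNormalJacobiFieldsOfCurvatureOne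
      (pow_pos hη 2)
  · exact hls η hη h1.ne' h.isLocallySymmetricMetric
  · refine (S3.isBerger_normalizedBergerMetric η hη).sectionalCurvature_pos (pow_pos hη 2)
      (pow_pos hη 2) ?_ p hvw
    have h2 := pow_lt_pow_left₀ h hη.le two_ne_zero
    rw [div_pow, Real.sq_sqrt (by norm_num)] at h2
    linarith
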